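/- **Definitions.** A rational vector field on $\mathbb{R}^n$ is an $n$-tuple $\mathbf{Q}=(Q_1,\dots,Q_n)$ of elements of $\mathbb{R}(x_1,\dots,x_n)$; it is $2$-homogeneous if every $Q_i$ is a homogeneous rational function of degree $2$ (or zero). In reduced form $\mathbf{Q}=(P_1/D,\dots,P_n/D)$ with polynomials $P_i$, $D\neq 0$ and $\gcd(P_1,\dots,P_n,D)=1$; $D$ is the common denominator of $\mathbf{Q}$. A map $\phi$ is a (local) projective flow with vector field $\mathbf{Q}$ if, near every point $\mathbf{x}$ with $D(\mathbf{x})\neq0$, $$\frac{1}{t+s}\,\phi\big((t+s)\mathbf{x}\big)=\frac1s\,\phi\Big(\frac st\,\phi(t\mathbf{x})\Big)\ \text{ for all small } s,t\neq 0,\ s+t\neq 0,$$ and $$\lim_{t\to0}\frac{\phi(t\mathbf{x})}{t}=\mathbf{x}$$ (both locally uniformly in $\mathbf{x}$), and $\frac{d}{dt}\big|_{t=0}\frac{\phi(t\mathbf{x})}{t}=\mathbf{Q}(\mathbf{x})$, where $\phi(t\mathbf{x})/t$ is read as $\mathbf{x}$ at $t=0$. Let $\Gamma\subset \mathrm{GL}(n,\mathbb{R})$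 be a finite group. A projective flow $\phi$ is a (projective) $\Gamma$-superflow if it has a vector field $\mathbf{Q}\neq 0$ that is rational and $2$-homogeneous and satisfies $\gamma^{-1}\circ\mathbf{Q}\circ\gamma=\mathbf{Q}$ for all $\gamma\in\Gamma$, and if every $2$-homogeneous rational vector field $\mathbf{Q}'$ with $\gamma^{-1}\circ\mathbf{Q}'\circ\gamma=\mathbf{Q}'$ for all $\gamma\in\Gamma$ is either a real scalar multiple of $\mathbf{Q}$ or has a common denominator of degree strictly higher than that of $\mathbf{Q}$. The full symmetry group of $\mathbf{Q}$ is $\{\gamma\in \mathrm{GL}(n,\mathbb{R}):\gamma^{-1}\circ\mathbf{Q}\circ\gamma=\mathbf{Q}\}$. Let $\mathbb{D}_m$ be the dihedral group of order $2m$ and $\mathbb{C}_m$ the cyclic group of order $m$. **Theorem** (classification of the symmetry groups of $2$-dimensional real superflows). 1. For every integer $d\ge1$ there are a subgroup $\Gamma\subset\mathrm{GL}(2,\mathbb{R})$ isomorphic to $\mathbb{D}_{2d+1}$ and a $\Gamma$-superflow whose vector field has full symmetry group exactly $\Gamma$. 2. For every integer $d\ge1$ and every subgroup $\Gamma\subset\mathrm{GL}(2,\mathbb{R})$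 isomorphic to $\mathbb{D}_{2d}$ there is no $\Gamma$-superflow. 3. For every integer $d\ge1$ and every subgroup $\Gamma\subset\mathrm{GL}(2,\mathbb{R})$ isomorphic to $\mathbb{C}_{d}$ there is no $\Gamma$-superflow. 4. Consequently, for a subgroup $\Gamma\subset\mathrm{GL}(2,\mathbb{R})$ there exists a $\Gamma$-superflow if and only if $\Gamma$ is isomorphic to $\mathbb{D}_{2d+1}$ for some integer $d\ge1$. -/

import Mathlib

open Filter Topology

noncomputable section

namespace Superflow

/-- Real polynomials in `n` variables. -/
abbrev Poly (n : ℕ) : Type := MvPolynomial (Fin n) ℝ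

/-- The field `ℝ(x₁, …, xₙ)` of real rational functions in `n` variables. -/
abbrev RatFun (n : ℕ) : Type := FractionRing (Poly n)

/-- Rational vector fields on `ℝⁿ`, given by their `n` components. -/
abbrev VectorField (n : ℕ) : Type := Fin n → RatFun n

variable {n : ℕ}

/-! ### Linear changes of variables -/

/-- The polynomial `p(γ x)`, where `(γ x)ᵢ = ∑ⱼ γᵢⱼ xⱼ`. -/
def polyComp (γ : GL (Fin n) ℝ) : Poly n →ₐ[ℝ] Poly n :=
  MvPolynomial.aeval fun i => ∑ j, MvPolynomial.C (γ i j) * MvPolynomial.X j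

theorem polyComp_one : polyComp (1 : GL (Fin n) ℝ) = AlgHom.id ℝ (Poly n) := by
  ext i : 1
  simp [polyComp, Matrix.one_apply]

theorem polyComp_mul (γ δ : GL (Fin n) ℝ) :
    polyComp (γ * δ) = (polyComp δ).comp (polyComp γ) := by
  ext i : 1
  simp only [polyComp, MvPolynomial.aeval_X, AlgHom.comp_apply, map_sum, map_mul,
    MvPolynomial.algHom_C, Units.val_mul, Matrix.mul_apply, MvPolynomial.algebraMap_eq,
    Finset.sum_mul, Finset.mul_sum, mul_assoc]
  exact Finset.sum_comm

theorem polyComp_injective (γ : GL (Fin n) ℝ) : Function.Injective (polyComp γ) := by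
  have h : (polyComp γ⁻¹).comp (polyComp γ) = AlgHom.id ℝ (Poly n) := by
    rw [← polyComp_mul, mul_inv_cancel, polyComp_one]
  have h' : Function.LeftInverse (polyComp γ⁻¹) (polyComp γ) := fun p => DFunLike.congr_fun h p
  exact h'.injective

/-- The rational function `f(γ x)`. -/
def ratComp (γ : GL (Fin n) ℝ) : RatFun n →+* RatFun n :=
  IsFractionRing.map (K := RatFun n) (L := RatFun n) (j := (polyComp γ).toRingHom)
    (polyComp_injective γ)

theorem ratComp_algebraMap (γ : GL (Fin n) ℝ) (p : Poly n) :
    ratComp γ (algebraMap (Poly n) (RatFun n) p) =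
      algebraMap (Poly n) (RatFun n) (polyComp γ p) := by
  simp [ratComp, IsFractionRing.map]

theorem ratComp_one : ratComp (1 : GL (Fin n) ℝ) = RingHom.id (RatFun n) := by
  apply IsLocalization.ringHom_ext (nonZeroDivisors (Poly n))
  refine RingHom.ext fun p => ?_
  simp only [RingHom.comp_apply, ratComp_algebraMap, polyComp_one, RingHom.id_apply,
    AlgHom.id_apply]

theorem ratComp_mul (γ δ : GL (Fin n) ℝ) :
    ratComp (γ * δ) = (ratComp δ).comp (ratComp γ) := by
  apply IsLocalization.ringHom_ext (nonZeroDivisors (Poly n))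
  refine RingHom.ext fun p => ?_
  simp only [RingHom.comp_apply, ratComp_algebraMap, polyComp_mul, AlgHom.comp_apply]

theorem ratComp_smul (γ : GL (Fin n) ℝ) (c : ℝ) (f : RatFun n) :
    ratComp γ (c • f) = c • ratComp γ f := by
  have h : ∀ g : RatFun n,
      c • g = algebraMap (Poly n) (RatFun n) (MvPolynomial.C c) * g := fun g => by
    rw [Algebra.smul_def, IsScalarTower.algebraMap_apply ℝ (Poly n) (RatFun n),
      MvPolynomial.algebraMap_eq]
  rw [h, h, map_mul, ratComp_algebraMap]
  simp [polyComp]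

/-- The vector field `γ⁻¹ ∘ Q ∘ γ`. -/
def conj (γ : GL (Fin n) ℝ) (Q : VectorField n) : VectorField n :=
  fun i => ∑ j, (γ⁻¹ : GL (Fin n) ℝ) i j • ratComp γ (Q j)

theorem conj_one (Q : VectorField n) : conj 1 Q = Q := by
  funext i
  simp [conj, ratComp_one, Matrix.one_apply]

theorem conj_mul (γ δ : GL (Fin n) ℝ) (Q : VectorField n) :
    conj (γ * δ) Q = conj δ (conj γ Q) := by
  funext i
  simp only [conj, ratComp_mul, RingHom.comp_apply, mul_inv_rev, Units.val_mul,
    Matrix.mul_apply, map_sum, ratComp_smul, Finset.smul_sum, Finset.sum_smul, smul_smul]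
  exact Finset.sum_comm

/-- The full (linear) symmetry group of a vector field:
all `γ ∈ GL(n, ℝ)` with `γ⁻¹ ∘ Q ∘ γ = Q`. -/
def symmetryGroup (Q : VectorField n) : Subgroup (GL (Fin n) ℝ) where
  carrier := {γ | conj γ Q = Q}
  one_mem' := conj_one Q
  mul_mem' := by
    intro γ δ hγ hδ
    simp only [Set.mem_ofPred_eq] at hγ hδ ⊢
    rw [conj_mul, hγ, hδ]
  inv_mem' := by
    intro γ hγ
    simp only [Set.mem_ofPred_eq] at hγ ⊢
    conv_lhs => rw [← hγ]
    rw [← conj_mul, mul_inv_cancel, conj_one]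

/-! ### Homogeneity and the reduced form -/

/-- A rational function is `2`-homogeneous if it is a quotient of two homogeneous polynomials
whose degrees differ by `2`. (Zero is included.) -/
def IsTwoHomogeneous (f : RatFun n) : Prop :=
  ∃ (m : ℕ) (p q : Poly n), p.IsHomogeneous (m + 2) ∧ q.IsHomogeneous m ∧ q ≠ 0 ∧
    f = algebraMap (Poly n) (RatFun n) p / algebraMap (Poly n) (RatFun n) q

/-- `Q = (P₁/D, …, Pₙ/D)` in reduced form: `gcd(P₁, …, Pₙ, D) = 1`. -/
structure IsReducedForm (Q : VectorField n) (P : Fin n → Poly n) (D : Poly n) : Prop where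
  denom_ne_zero : D ≠ 0
  eq_div : ∀ i, Q i = algebraMap (Poly n) (RatFun n) (P i) / algebraMap (Poly n) (RatFun n) D
  isUnit_of_dvd : ∀ g : Poly n, g ∣ D → (∀ i, g ∣ P i) → IsUnit g

theorem exists_isReducedForm (Q : VectorField n) :
    ∃ PD : (Fin n → Poly n) × Poly n, IsReducedForm Q PD.1 PD.2 := by
  classical
  let S : Set ((Fin n → Poly n) × Poly n) := {PD | PD.2 ≠ 0 ∧
    ∀ i, Q i = algebraMap (Poly n) (RatFun n) (PD.1 i) / algebraMap (Poly n) (RatFun n) PD.2}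
  have hS : S.Nonempty := by
    obtain ⟨b, hb⟩ := IsLocalization.exist_integer_multiples_of_finite
      (nonZeroDivisors (Poly n)) Q
    choose P hP using hb
    have hb0 : (b : Poly n) ≠ 0 := nonZeroDivisors.coe_ne_zero b
    refine ⟨(P, b), hb0, fun i => ?_⟩
    have h0 : algebraMap (Poly n) (RatFun n) b ≠ 0 := by simp
    rw [eq_div_iff h0, hP i, Algebra.smul_def, mul_comm]
  let deg : (Fin n → Poly n) × Poly n → ℕ := fun PD => PD.2.totalDegree
  let m := Function.argminOn deg S hS
  have hm : m ∈ S := Function.argminOn_mem deg S hS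
  refine ⟨m, hm.1, hm.2, ?_⟩
  rintro g ⟨D', hD'⟩ hgP
  choose P' hP' using hgP
  have hg : g ≠ 0 := fun h => hm.1 (by rw [hD', h, zero_mul])
  have hD0 : D' ≠ 0 := fun h => hm.1 (by rw [hD', h, mul_zero])
  have hmem : (P', D') ∈ S := by
    refine ⟨hD0, fun i => ?_⟩
    rw [hm.2 i, hP' i, hD', map_mul, map_mul]
    exact mul_div_mul_left _ _ (by simpa using hg)
  have hle : m.2.totalDegree ≤ D'.totalDegree := Function.argminOn_le deg S hmem
  rw [hD', MvPolynomial.totalDegree_mul_of_isDomain hg hD0] at hle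
  have hg0 : g.totalDegree = 0 := by omega
  rw [MvPolynomial.totalDegree_eq_zero_iff_eq_C] at hg0
  have hc : MvPolynomial.coeff 0 g ≠ 0 := fun h => hg (by rw [hg0, h, map_zero])
  rw [hg0]
  exact (isUnit_iff_ne_zero.mpr hc).map MvPolynomial.C

/-- The numerators in a reduced form of `Q` (unique up to a common real factor). -/
def numer (Q : VectorField n) : Fin n → Poly n := (exists_isReducedForm Q).choose.1

/-- The common denominator in a reduced form of `Q` (unique up to a real factor). -/
def denom (Q : VectorField n) : Poly n := (exists_isReducedForm Q).choose.2

theorem isReducedForm (Q : VectorField n) : IsReducedForm Q (numer Q) (denom Q) :=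
  (exists_isReducedForm Q).choose_spec

/-- The points of `ℝⁿ` at which the common denominator of `Q` does not vanish. -/
def regularSet (Q : VectorField n) : Set (Fin n → ℝ) :=
  {x | MvPolynomial.eval x (denom Q) ≠ 0}

/-- The value `Q(x) ∈ ℝⁿ` at a point of `regularSet Q`. -/
def value (Q : VectorField n) (x : Fin n → ℝ) : Fin n → ℝ :=
  fun i => MvPolynomial.eval x (numer Q i) / MvPolynomial.eval x (denom Q)

/-! ### Projective flows -/

/-- `φ` is a (local) projective flow with vector field `Q`. Writing `φᵗ(x) = t⁻¹ φ(t x)`, around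
every point where `Q` is defined `φ` satisfies

* the projective translation equation
  `(t + s)⁻¹ φ((t + s) x) = s⁻¹ φ((s / t) φ(t x))` for all small `s`, `t`,
* the boundary condition `φᵗ(x) → x` as `t → 0`,

both locally uniformly in `x`, and `Q(x)` is the derivative of `φᵗ(x)` at `t = 0`.
The values of `φ` far from the origin (where the flow may not be defined) are irrelevant. -/
structure IsProjectiveFlow (φ : (Fin n → ℝ) → (Fin n → ℝ)) (Q : VectorField n) : Prop where
  translation : ∀ x ∈ regularSet Q, ∃ ε > 0, ∀ y, dist y x < ε → ∀ s t : ℝ,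
    |s| < ε → |t| < ε → s ≠ 0 → t ≠ 0 → t + s ≠ 0 →
      (t + s)⁻¹ • φ ((t + s) • y) = s⁻¹ • φ ((s / t) • φ (t • y))
  boundary : ∀ x ∈ regularSet Q,
    Tendsto (fun p : (Fin n → ℝ) × ℝ => p.2⁻¹ • φ (p.2 • p.1)) (𝓝 x ×ˢ 𝓝[≠] 0) (𝓝 x)
  vectorField : ∀ x ∈ regularSet Q,
    HasDerivAt (fun t : ℝ => if t = 0 then x else t⁻¹ • φ (t • x)) (value Q x) 0

/-! ### Projective superflows -/

/-- `Q` is a nonzero `2`-homogeneous rational vector field invariant under the finite group `Γ`,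
and every other such vector field is a scalar multiple of `Q` or has a common denominator of higher
degree. -/
structure IsSuperflowField (Γ : Subgroup (GL (Fin n) ℝ)) (Q : VectorField n) : Prop where
  finite : Finite Γ
  ne_zero : Q ≠ 0
  homogeneous : ∀ i, IsTwoHomogeneous (Q i)
  invariant : ∀ γ ∈ Γ, conj γ Q = Q
  unique : ∀ Q' : VectorField n, (∀ i, IsTwoHomogeneous (Q' i)) → (∀ γ ∈ Γ, conj γ Q' = Q') →
    (∃ c : ℝ, Q' = c • Q) ∨ (denom Q).totalDegree < (denom Q').totalDegree

/-- `φ` is a projective `Γ`-superflow. -/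
def IsSuperflow (Γ : Subgroup (GL (Fin n) ℝ)) (φ : (Fin n → ℝ) → (Fin n → ℝ)) : Prop :=
  ∃ Q : VectorField n, IsProjectiveFlow φ Q ∧ IsSuperflowField Γ Q

/-- `φ` is a projective `Γ`-superflow, and `Γ` is the full group of linear symmetries of its
vector field. -/
def IsSuperflowWithSymmetryGroup (Γ : Subgroup (GL (Fin n) ℝ))
    (φ : (Fin n → ℝ) → (Fin n → ℝ)) : Prop :=
  ∃ Q : VectorField n, IsProjectiveFlow φ Q ∧ IsSuperflowField Γ Q ∧ symmetryGroup Q = Γ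

end Superflow

end

/-! Flows are no obstruction. A `2`-homogeneous rational field is smooth off the zero set of its
denominator, and homogeneity makes its time-one map φ satisfy φ(s α(t)) = s α(t + s) along every
trajectory α. Hence φ(tx)/t is the ordinary local flow, and the projective translation equation is
its group law. By `exists_isProjectiveFlow` only the algebra of invariant fields remains.

The superflow condition is stable under linear conjugation (`IsSuperflowField.conj`). Averaging an
inner product makes a finite Γ orthogonal, so up to conjugation Γ consists of rotations or is the
standard dihedral group of order 2M (`exists_conj_rotations_or_dihedral`). Three cases are excluded.
If Γ consists of rotations, the quarter turn J commutes with it, so JQ is invariant over the same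
denominator, but JQ = cQ would force c² = -1. If M is even, -1 lies in Γ and forces Q = -Q. If M =
1, there are two independent invariant quadratic fields.

For M = 2e + 3, in the coordinate z = x + iy, the field is z̄^(2e+2) / |z|^(2e). A rotation acts
diagonally on the monomials z^a z̄^b. For a denominator of degree at most 2e, congruences modulo 2e
+ 3 leave only (z z̄)^e below and z̄^(2e+2) above, unless the field vanishes; the reflection makes
the remaining coefficient real (`exists_eq_smul_dihedralField`).

For a symmetry γ of this field, |γ(ū^(2e+2))| = |γu|² on the unit circle. Looking at the extrema of
|γu| shows that γ is an isometry, and evaluation at 1 then determines which rotations occur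
(`symmetryGroup_dihedralField`). -/

noncomputable section

namespace Superflow

/-! ### Trajectories, time-one maps and local flows -/

section Flow
variable {E : Type*} [NormedAddCommGroup E] [NormedSpace ℝ E]

/-- `α` is a trajectory in `U` of the vector field `V` over the time interval `[a, b]`. -/
def IsTrajectoryOn (V : E → E) (U : Set E) (α : ℝ → E) (a b : ℝ) : Prop :=
  ∀ t ∈ Set.Icc a b, HasDerivAt α (V (α t)) t ∧ α t ∈ U

/-- The two trajectories together sweep out a compact set, on which the locally Lipschitz `V` is
Lipschitz; Grönwall uniqueness for ODEs then applies. -/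
theorem IsTrajectoryOn.eq_of_eq_left {V : E → E} {U : Set E}
    (hV : ∀ x ∈ U, ContDiffAt ℝ 1 V x) {α β : ℝ → E} {a b : ℝ} (hab : a ≤ b)
    (hα : IsTrajectoryOn V U α a b) (hβ : IsTrajectoryOn V U β a b) (h : α a = β a) :
    α b = β b := by
  have cα : ContinuousOn α (Set.Icc a b) :=
    fun t ht => (hα t ht).1.continuousAt.continuousWithinAt
  have cβ : ContinuousOn β (Set.Icc a b) :=
    fun t ht => (hβ t ht).1.continuousAt.continuousWithinAt
  have hK : IsCompact (α '' Set.Icc a b ∪ β '' Set.Icc a b) :=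
    (isCompact_Icc.image_of_continuousOn cα).union (isCompact_Icc.image_of_continuousOn cβ)
  have hL : LocallyLipschitzOn (α '' Set.Icc a b ∪ β '' Set.Icc a b) V := by
    intro x hx
    have hxU : x ∈ U := by
      rcases hx with ⟨t, ht, rfl⟩ | ⟨t, ht, rfl⟩
      exacts [(hα t ht).2, (hβ t ht).2]
    obtain ⟨K, s, hs, hKs⟩ := (hV x hxU).exists_lipschitzOnWith
    exact ⟨K, s, mem_nhdsWithin_of_mem_nhds hs, hKs⟩
  obtain ⟨K, hKL⟩ := hL.exists_lipschitzOnWith_of_compact hK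
  have hsub : Set.Ico a b ⊆ Set.Icc a b := Set.Ico_subset_Icc_self
  exact ODE_solution_unique_of_mem_Icc_right (v := fun _ => V) (fun _ _ => hKL)
    cα (fun t ht => (hα t (hsub ht)).1.hasDerivWithinAt)
    (fun t ht => Or.inl ⟨t, hsub ht, rfl⟩)
    cβ (fun t ht => (hβ t (hsub ht)).1.hasDerivWithinAt)
    (fun t ht => Or.inr ⟨t, hsub ht, rfl⟩) h ⟨hab, le_rfl⟩

open Classical in
/-- The time-one map of the vector field `V` on `U` (zero where it is undefined). -/
def timeOne (V : E → E) (U : Set E) (v : E) : E :=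
  if h : ∃ α : ℝ → E, IsTrajectoryOn V U α 0 1 ∧ α 0 = v then h.choose 1 else 0

theorem IsTrajectoryOn.timeOne_eq {V : E → E} {U : Set E}
    (hV : ∀ x ∈ U, ContDiffAt ℝ 1 V x) {α : ℝ → E} (hα : IsTrajectoryOn V U α 0 1) :
    timeOne V U (α 0) = α 1 := by
  have h : ∃ β : ℝ → E, IsTrajectoryOn V U β 0 1 ∧ β 0 = α 0 := ⟨α, hα, rfl⟩
  rw [timeOne, dif_pos h]
  exact h.choose_spec.1.eq_of_eq_left hV zero_le_one hα h.choose_spec.2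

/-- Along a trajectory `α` of a `2`-homogeneous vector field, the time-one map sends `s α(t)` to
`s α(t + s)`. -/
theorem timeOne_smul {V : E → E} {U : Set E} (hV : ∀ x ∈ U, ContDiffAt ℝ 1 V x)
    (hU : ∀ c : ℝ, c ≠ 0 → ∀ x ∈ U, c • x ∈ U)
    (hom : ∀ c : ℝ, c ≠ 0 → ∀ x ∈ U, V (c • x) = c ^ 2 • V x)
    {α : ℝ → E} {δ : ℝ} (hα : ∀ t, |t| < δ → HasDerivAt α (V (α t)) t ∧ α t ∈ U)
    {t s : ℝ} (ht : |t| < δ) (hts : |t + s| < δ) (hs : s ≠ 0) :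
    timeOne V U (s • α t) = s • α (t + s) := by
  -- One factor `s` comes from the chain rule and one from the outer scaling; together they match `V
  -- (s • x) = s ^ 2 • V x`.
  have key : IsTrajectoryOn V U (fun τ => s • α (t + s * τ)) 0 1 := by
    intro τ hτ
    have hτδ : |t + s * τ| < δ := by
      rw [abs_lt] at ht hts ⊢
      obtain ⟨h0, h1⟩ := hτ
      -- A convex combination of the end times, so it stays in the interval `(-δ, δ)`.
      have e : t + s * τ = (1 - τ) * t + τ * (t + s) := by ring
      rw [e]
      rcases h0.eq_or_lt with rfl | h0
      · simpa using ht
      · constructor <;> nlinarith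
    obtain ⟨hd, hu⟩ := hα _ hτδ
    refine ⟨?_, hU s hs _ hu⟩
    have h1 : HasDerivAt (fun τ : ℝ => t + s * τ) s τ := by
      simpa using ((hasDerivAt_id τ).const_mul s).const_add t
    have h2 := (hd.scomp τ h1).const_smul s
    rw [hom s hs _ hu, pow_two, mul_smul]
    exact h2
  simpa using key.timeOne_eq hV

/-- Local flow of a `C¹` vector field on an open set. -/
theorem exists_local_flow [CompleteSpace E] {V : E → E} {U : Set E} (hUo : IsOpen U) {x : E}
    (hx : x ∈ U) (hV : ContDiffAt ℝ 1 V x) :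
    ∃ δ > 0, ∃ β : E × ℝ → E, ContinuousAt β (x, 0) ∧ β (x, 0) = x ∧
      ∀ y, dist y x < δ → β (y, 0) = y ∧
        ∀ t, |t| < δ → HasDerivAt (fun τ => β (y, τ)) (V (β (y, t))) t ∧ β (y, t) ∈ U := by
  obtain ⟨ε, hε, a, r, L, K, hr, hpl⟩ := IsPicardLindelof.of_contDiffAt_one hV
  obtain ⟨β, hβ, hc⟩ :=
    (hpl 0).exists_forall_mem_closedBall_eq_hasDerivWithinAt_continuousOn
  have hr' : (0 : ℝ) < r := hr
  have hIcc : ∀ t : ℝ, |t| < ε → Set.Icc (0 - ε) (0 + ε) ∈ 𝓝 t := fun t ht => by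
    rw [abs_lt] at ht
    exact Icc_mem_nhds (by linarith) (by linarith)
  have hcx : ContinuousAt β (x, 0) := hc.continuousAt
    (prod_mem_nhds (Metric.closedBall_mem_nhds x hr') (hIcc 0 (by simpa using hε)))
  have hβx : β (x, 0) = x := (hβ x (Metric.mem_closedBall_self hr'.le)).1
  have hev : ∀ᶠ p in 𝓝 (x, (0 : ℝ)), β p ∈ U :=
    hcx.eventually (by rw [hβx]; exact hUo.mem_nhds hx)
  obtain ⟨η, hη, hηU⟩ := Metric.eventually_nhds_iff.1 hev
  -- `ε` and `r` bound the time and the starting points in Picard–Lindelöf; `η` keeps the flow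
  -- inside `U`.
  refine ⟨min η (min ε r), by positivity, β, hcx, hβx, fun y hy => ?_⟩
  simp only [lt_min_iff] at hy
  obtain ⟨h0, hd⟩ := hβ y (Metric.mem_closedBall.2 hy.2.2.le)
  refine ⟨h0, fun t ht => ?_⟩
  simp only [lt_min_iff] at ht
  refine ⟨(hd t (mem_of_mem_nhds (hIcc t ht.2.1))).hasDerivAt (hIcc t ht.2.1), hηU ?_⟩
  rw [Prod.dist_eq, max_lt_iff]
  exact ⟨hy.1, by simpa using ht.1⟩

end Flow

/-- A vector field whose value map is smooth and `2`-homogeneous has a projective flow. -/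
theorem exists_isProjectiveFlow_of_value {n : ℕ} {Q : VectorField n}
    (hUo : IsOpen (regularSet Q))
    (hV : ∀ x ∈ regularSet Q, ContDiffAt ℝ 1 (value Q) x)
    (hU : ∀ c : ℝ, c ≠ 0 → ∀ x ∈ regularSet Q, c • x ∈ regularSet Q)
    (hom : ∀ c : ℝ, c ≠ 0 → ∀ x ∈ regularSet Q, value Q (c • x) = c ^ 2 • value Q x) :
    ∃ φ, IsProjectiveFlow φ Q := by
  refine ⟨timeOne (value Q) (regularSet Q), ?_, ?_, ?_⟩
  · intro x hx
    obtain ⟨δ, hδ, β, -, -, hβ⟩ := exists_local_flow hUo hx (hV x hx)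
    -- Half of `δ`, so that `t + s` is still an admissible time.
    refine ⟨δ / 2, by positivity, fun y hy s t hs ht hs0 ht0 hts => ?_⟩
    obtain ⟨hy0, hd⟩ := hβ y (by linarith)
    have hδ0 : |(0 : ℝ)| < δ := by simpa using hδ
    have htsδ : |t + s| < δ := (abs_add_le t s).trans_lt (by linarith)
    have e1 := timeOne_smul hV hU hom hd (t := 0) (s := t + s) hδ0 (by simpa using htsδ) hts
    have e2 := timeOne_smul hV hU hom hd (t := 0) (s := t) hδ0
      (by simpa using ht.trans (by linarith)) ht0
    have e3 := timeOne_smul hV hU hom hd (t := t) (s := s) (by linarith) htsδ hs0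
    rw [hy0, zero_add] at e1 e2
    rw [e1, e2, smul_smul (s / t), div_mul_cancel₀ _ ht0, e3, inv_smul_smul₀ hts, inv_smul_smul₀ hs0]
  · intro x hx
    obtain ⟨δ, hδ, β, hc, hβx, hβ⟩ := exists_local_flow hUo hx (hV x hx)
    have hlim : Tendsto β (𝓝 x ×ˢ 𝓝[≠] 0) (𝓝 x) := by
      have h := hc.tendsto
      rw [hβx, nhds_prod_eq] at h
      exact h.mono_left (Filter.prod_mono le_rfl nhdsWithin_le_nhds)
    refine hlim.congr' ?_
    have h1 : ∀ᶠ y in 𝓝 x, dist y x < δ := Metric.ball_mem_nhds x hδ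
    have h2 : ∀ᶠ t in 𝓝[≠] (0 : ℝ), |t| < δ ∧ t ≠ 0 := by
      refine Filter.Eventually.and (mem_nhdsWithin_of_mem_nhds ?_) self_mem_nhdsWithin
      filter_upwards [Metric.ball_mem_nhds (0 : ℝ) hδ] with t ht
      simpa using ht
    filter_upwards [h1.prod_mk h2] with p hp
    obtain ⟨hy0, hd⟩ := hβ p.1 hp.1
    have e := timeOne_smul hV hU hom hd (t := 0) (s := p.2) (by simpa using hδ)
      (by simpa using hp.2.1) hp.2.2
    rw [hy0, zero_add] at e
    rw [e, inv_smul_smul₀ hp.2.2]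
  · intro x hx
    obtain ⟨δ, hδ, β, -, hβx, hβ⟩ := exists_local_flow hUo hx (hV x hx)
    obtain ⟨hy0, hd⟩ := hβ x (by simpa using hδ)
    have h0 := (hd 0 (by simpa using hδ)).1
    rw [hβx] at h0
    refine h0.congr_of_eventuallyEq ?_
    filter_upwards [Metric.ball_mem_nhds (0 : ℝ) hδ] with t ht
    split_ifs with h
    · rw [h, hβx]
    · have e := timeOne_smul hV hU hom hd (t := 0) (s := t) (by simpa using hδ)
        (by simpa using ht) h
      rw [hy0, zero_add] at e
      rw [e, inv_smul_smul₀ h]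

section ChangeOfVariables

variable {n : ℕ}

/-! ### Scaling and homogeneous polynomials -/

/-- The polynomial `p(c x)`. -/
def scale (c : ℝ) : Poly n →ₐ[ℝ] Poly n :=
  MvPolynomial.aeval fun i => MvPolynomial.C c * MvPolynomial.X i

theorem scale_monomial (c : ℝ) (k : Fin n →₀ ℕ) (a : ℝ) :
    scale c (MvPolynomial.monomial k a) = MvPolynomial.monomial k (c ^ k.degree * a) := by
  rw [scale, MvPolynomial.aeval_monomial, MvPolynomial.monomial_eq]
  simp only [Finsupp.prod, mul_pow, Finset.prod_mul_distrib, Finset.prod_pow_eq_pow_sum,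
    MvPolynomial.algebraMap_eq, map_mul, map_pow, Finsupp.degree_apply]
  ring

theorem coeff_scale (c : ℝ) (k : Fin n →₀ ℕ) (p : Poly n) :
    MvPolynomial.coeff k (scale c p) = c ^ k.degree * MvPolynomial.coeff k p := by
  classical
  induction p using MvPolynomial.induction_on' with
  | monomial l a =>
    rw [scale_monomial, MvPolynomial.coeff_monomial, MvPolynomial.coeff_monomial]
    split_ifs with h
    · rw [h]
    · simp
  | add p q hp hq => rw [map_add, MvPolynomial.coeff_add, hp, hq, MvPolynomial.coeff_add, mul_add]

theorem scale_of_isHomogeneous {p : Poly n} {N : ℕ} (hp : p.IsHomogeneous N) (c : ℝ) :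
    scale c p = MvPolynomial.C (c ^ N) * p := by
  ext k
  rw [coeff_scale, MvPolynomial.coeff_C_mul]
  by_cases h : MvPolynomial.coeff k p = 0
  · simp [h]
  · rw [← not_imp_comm.1 hp.coeff_eq_zero h]

theorem eval_scale (c : ℝ) (x : Fin n → ℝ) (p : Poly n) :
    MvPolynomial.eval x (scale c p) = MvPolynomial.eval (c • x) p := by
  induction p using MvPolynomial.induction_on with
  | C a => simp [scale]
  | add p q hp hq => simp [hp, hq]
  | mul_X p i hp => rw [map_mul, map_mul, hp]; simp [scale]

theorem eval_smul_of_isHomogeneous {p : Poly n} {N : ℕ} (hp : p.IsHomogeneous N) (c : ℝ)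
    (x : Fin n → ℝ) : MvPolynomial.eval (c • x) p = c ^ N * MvPolynomial.eval x p := by
  rw [← eval_scale, scale_of_isHomogeneous hp, map_mul, MvPolynomial.eval_C]

theorem totalDegree_scale {c : ℝ} (hc : c ≠ 0) (p : Poly n) :
    (scale c p).totalDegree = p.totalDegree := by
  have h : (scale c p).support = p.support := by
    ext k
    simp [MvPolynomial.mem_support_iff, coeff_scale, hc]
  rw [MvPolynomial.totalDegree, MvPolynomial.totalDegree, h]

/-- The single factor `2` suffices, since its powers are distinct: any monomial that occurs must
have degree `N`. -/
theorem isHomogeneous_of_scale_two {p : Poly n} {N : ℕ}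
    (h : scale 2 p = MvPolynomial.C (2 ^ N) * p) : p.IsHomogeneous N := by
  intro k hk
  have h1 := congrArg (MvPolynomial.coeff k) h
  rw [coeff_scale, MvPolynomial.coeff_C_mul] at h1
  change Finsupp.weight (fun _ => 1) k = N
  rw [← Finsupp.degree_eq_weight_one]
  exact pow_right_injective₀ (by norm_num) (by norm_num) (mul_right_cancel₀ hk h1)

theorem eq_C_mul_of_dvd_of_totalDegree_le {p q : Poly n} (h : p ∣ q)
    (hq : q ≠ 0) (hd : q.totalDegree ≤ p.totalDegree) :
    ∃ c : ℝ, c ≠ 0 ∧ q = MvPolynomial.C c * p := by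
  obtain ⟨e, rfl⟩ := h
  obtain ⟨hp0, he0⟩ := mul_ne_zero_iff.1 hq
  rw [MvPolynomial.totalDegree_mul_of_isDomain hp0 he0] at hd
  have he : e.totalDegree = 0 := by omega
  rw [MvPolynomial.totalDegree_eq_zero_iff_eq_C] at he
  refine ⟨MvPolynomial.coeff 0 e, fun h0 => he0 (by rw [he, h0, map_zero]), ?_⟩
  rw [← he, mul_comm]

/-! ### Reduced forms -/

/-- `D` divides `e` times the gcd of the `P i` and is relatively prime to that gcd. -/
theorem IsReducedForm.dvd_of_dvd_mul {Q : VectorField n} {P : Fin n → Poly n} {D : Poly n}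
    (h : IsReducedForm Q P D) {e : Poly n} (he : ∀ i, D ∣ e * P i) : D ∣ e := by
  classical
  let _ : NormalizedGCDMonoid (Poly n) := Classical.choice inferInstance
  have h1 : IsRelPrime D (Finset.univ.gcd P) := fun g hD hG =>
    h.isUnit_of_dvd g hD fun i => hG.trans (Finset.gcd_dvd (Finset.mem_univ i))
  have h2 : D ∣ Finset.univ.gcd fun i => e * P i := Finset.dvd_gcd fun i _ => he i
  have h3 : D ∣ e * Finset.univ.gcd P :=
    h2.trans (Finset.gcd_mul_left' Finset.univ P e).dvd
  exact h1.dvd_of_dvd_mul_right h3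

theorem algebraMap_ne_zero {p : Poly n} (hp : p ≠ 0) :
    algebraMap (Poly n) (RatFun n) p ≠ 0 := by
  simpa using hp

theorem numer_mul_eq (Q : VectorField n) {i : Fin n} {p q : Poly n} (hq : q ≠ 0)
    (h : Q i = algebraMap (Poly n) (RatFun n) p / algebraMap (Poly n) (RatFun n) q) :
    numer Q i * q = p * denom Q := by
  have h1 := (isReducedForm Q).eq_div i
  rw [h, div_eq_div_iff (algebraMap_ne_zero hq)
    (algebraMap_ne_zero (isReducedForm Q).denom_ne_zero)] at h1
  apply IsFractionRing.injective (Poly n) (RatFun n)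
  rw [map_mul, map_mul, h1]

theorem denom_dvd {Q : VectorField n} {p : Fin n → Poly n} {q : Poly n} (hq : q ≠ 0)
    (h : ∀ i, Q i = algebraMap (Poly n) (RatFun n) (p i) / algebraMap (Poly n) (RatFun n) q) :
    denom Q ∣ q :=
  (isReducedForm Q).dvd_of_dvd_mul fun i => by
    rw [mul_comm, numer_mul_eq Q hq (h i)]
    exact dvd_mul_left _ _

theorem totalDegree_denom_le {Q : VectorField n} {p : Fin n → Poly n} {q : Poly n} (hq : q ≠ 0)
    (h : ∀ i, Q i = algebraMap (Poly n) (RatFun n) (p i) / algebraMap (Poly n) (RatFun n) q) :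
    (denom Q).totalDegree ≤ q.totalDegree := by
  obtain ⟨e, he⟩ := denom_dvd hq h
  have he0 : e ≠ 0 := by
    rintro rfl
    exact hq (by rw [he, mul_zero])
  rw [he, MvPolynomial.totalDegree_mul_of_isDomain (isReducedForm Q).denom_ne_zero he0]
  omega

/-- The reduced form of a `2`-homogeneous vector field is homogeneous. -/
theorem isHomogeneous_denom_numer {Q : VectorField n} (hQ : ∀ i, IsTwoHomogeneous (Q i)) :
    (denom Q).IsHomogeneous (denom Q).totalDegree ∧
      ∀ i, (numer Q i).IsHomogeneous ((denom Q).totalDegree + 2) := by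
  have hD0 := (isReducedForm Q).denom_ne_zero
  -- This is Q(2x) = 4 Q(x) cleared of denominators.
  have key : ∀ i, scale 2 (numer Q i) * denom Q
      = MvPolynomial.C 4 * numer Q i * scale 2 (denom Q) := by
    intro i
    obtain ⟨m, p, q, hp, hq, hq0, h⟩ := hQ i
    have h1 := numer_mul_eq Q hq0 h
    have h2 := congrArg (scale 2) h1
    rw [map_mul, map_mul, scale_of_isHomogeneous hp, scale_of_isHomogeneous hq, pow_add,
      map_mul] at h2
    have hC : (MvPolynomial.C ((2 : ℝ) ^ m) : Poly n) ≠ 0 := by simp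
    apply mul_right_cancel₀ (mul_ne_zero hC hq0)
    have h4 : (MvPolynomial.C ((2 : ℝ) ^ 2) : Poly n) = MvPolynomial.C 4 := by norm_num
    rw [h4] at h2
    linear_combination denom Q * h2 -
      MvPolynomial.C 4 * scale 2 (denom Q) * MvPolynomial.C ((2 : ℝ) ^ m) * h1
  -- By `key` and coprimality D(x) divides D(2x). The degrees agree, so the quotient is a constant,
  -- and comparing one coefficient shows that it is a power of 2.
  have hdvd : denom Q ∣ scale 2 (denom Q) := by
    refine (isReducedForm Q).dvd_of_dvd_mul fun i => ?_
    have h4 : (MvPolynomial.C (4 : ℝ) : Poly n) * MvPolynomial.C (1 / 4) = 1 := by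
      rw [← map_mul]; norm_num
    refine ⟨MvPolynomial.C (1 / 4) * scale 2 (numer Q i), ?_⟩
    linear_combination (-MvPolynomial.C (1 / 4)) * key i
      - numer Q i * scale 2 (denom Q) * h4
  have hs0 : scale 2 (denom Q) ≠ 0 := by
    obtain ⟨k, hk⟩ := MvPolynomial.ne_zero_iff.1 hD0
    exact MvPolynomial.ne_zero_iff.2 ⟨k, by rw [coeff_scale]; positivity⟩
  obtain ⟨c, hc0, hc⟩ := eq_C_mul_of_dvd_of_totalDegree_le hdvd hs0
    (totalDegree_scale two_ne_zero _).le
  obtain ⟨k, hk⟩ := MvPolynomial.ne_zero_iff.1 hD0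
  have hck : (2 : ℝ) ^ k.degree = c := by
    have h1 := congrArg (MvPolynomial.coeff k) hc
    rw [coeff_scale, MvPolynomial.coeff_C_mul] at h1
    exact mul_right_cancel₀ hk h1
  rw [← hck] at hc
  have hD : (denom Q).IsHomogeneous k.degree := isHomogeneous_of_scale_two hc
  rw [hD.totalDegree hD0]
  refine ⟨hD, fun i => isHomogeneous_of_scale_two ?_⟩
  have h1 := key i
  rw [hc] at h1
  apply mul_right_cancel₀ hD0
  have h4 : (MvPolynomial.C ((2 : ℝ) ^ (k.degree + 2)) : Poly n)
      = MvPolynomial.C 4 * MvPolynomial.C (2 ^ k.degree) := by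
    rw [← map_mul, pow_add]; norm_num [mul_comm]
  rw [h1, h4]
  ring

theorem exists_isProjectiveFlow {Q : VectorField n} (hQ : ∀ i, IsTwoHomogeneous (Q i)) :
    ∃ φ, IsProjectiveFlow φ Q := by
  obtain ⟨hD, hP⟩ := isHomogeneous_denom_numer hQ
  have hsm : ∀ (p : Poly n) (x : Fin n → ℝ),
      ContDiffAt ℝ 1 (fun y => MvPolynomial.eval y p) x := fun p x =>
    (AnalyticOnNhd.eval_mvPolynomial p x (Set.mem_univ x)).contDiffAt
  refine exists_isProjectiveFlow_of_value ?_ (fun x hx => ?_) (fun c hc x hx => ?_)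
    (fun c hc x hx => ?_)
  · exact isOpen_ne_fun (MvPolynomial.continuous_eval _) continuous_const
  · exact contDiffAt_pi.2 fun i => (hsm _ x).div (hsm _ x) hx
  · change MvPolynomial.eval (c • x) (denom Q) ≠ 0
    rw [eval_smul_of_isHomogeneous hD]
    exact mul_ne_zero (pow_ne_zero _ hc) hx
  · have hx' : MvPolynomial.eval x (denom Q) ≠ 0 := hx
    funext i
    simp only [value, Pi.smul_apply, smul_eq_mul]
    rw [eval_smul_of_isHomogeneous hD, eval_smul_of_isHomogeneous (hP i)]
    field_simp
    ring

/-! ### Linear changes of variables and reduced forms -/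

theorem eval_polyComp (γ : GL (Fin n) ℝ) (x : Fin n → ℝ) (p : Poly n) :
    MvPolynomial.eval x (polyComp γ p)
      = MvPolynomial.eval ((γ : Matrix (Fin n) (Fin n) ℝ).mulVec x) p := by
  induction p using MvPolynomial.induction_on with
  | C a => simp [polyComp]
  | add p q hp hq => simp [hp, hq]
  | mul_X p i hp =>
    rw [map_mul, map_mul, hp, map_mul]
    simp [polyComp, Matrix.mulVec, dotProduct]

theorem isHomogeneous_polyComp (γ : GL (Fin n) ℝ) {p : Poly n} {N : ℕ}
    (hp : p.IsHomogeneous N) : (polyComp γ p).IsHomogeneous N := by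
  have h := hp.aeval (fun i => ∑ j, MvPolynomial.C (γ i j) * MvPolynomial.X j : Fin n → Poly n)
    (n := 1) fun i => MvPolynomial.IsHomogeneous.sum _ _ _ fun j _ =>
      MvPolynomial.isHomogeneous_C_mul_X _ _
  rwa [one_mul] at h

theorem polyComp_ne_zero (γ : GL (Fin n) ℝ) {p : Poly n} (hp : p ≠ 0) : polyComp γ p ≠ 0 :=
  (map_ne_zero_iff _ (polyComp_injective γ)).2 hp

theorem totalDegree_polyComp (γ : GL (Fin n) ℝ) {p : Poly n} {N : ℕ}
    (hp : p.IsHomogeneous N) : (polyComp γ p).totalDegree = p.totalDegree := by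
  by_cases h : p = 0
  · simp [h]
  · rw [hp.totalDegree h, (isHomogeneous_polyComp γ hp).totalDegree (polyComp_ne_zero γ h)]

/-- The numerators of `γ⁻¹ ∘ Q ∘ γ` over the denominator `D ∘ γ`, given the numerators `P` of
`Q`. -/
def conjNumer (γ : GL (Fin n) ℝ) (P : Fin n → Poly n) (i : Fin n) : Poly n :=
  ∑ j, MvPolynomial.C ((γ⁻¹ : GL (Fin n) ℝ) i j) * polyComp γ (P j)

theorem ratFun_smul_eq (c : ℝ) (g : RatFun n) :
    c • g = algebraMap (Poly n) (RatFun n) (MvPolynomial.C c) * g := by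
  rw [Algebra.smul_def, IsScalarTower.algebraMap_apply ℝ (Poly n) (RatFun n),
    MvPolynomial.algebraMap_eq]

theorem conj_apply_eq_div (γ : GL (Fin n) ℝ) {Q : VectorField n} {P : Fin n → Poly n}
    {D : Poly n}
    (h : ∀ i, Q i = algebraMap (Poly n) (RatFun n) (P i) / algebraMap (Poly n) (RatFun n) D)
    (i : Fin n) :
    conj γ Q i = algebraMap (Poly n) (RatFun n) (conjNumer γ P i) /
      algebraMap (Poly n) (RatFun n) (polyComp γ D) := by
  simp only [conj, conjNumer, map_sum, Finset.sum_div, h, map_div₀, ratComp_algebraMap,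
    ratFun_smul_eq, map_mul, mul_div_assoc]

theorem isHomogeneous_conjNumer (γ : GL (Fin n) ℝ) {P : Fin n → Poly n} {N : ℕ}
    (hP : ∀ i, (P i).IsHomogeneous N) (i : Fin n) : (conjNumer γ P i).IsHomogeneous N :=
  MvPolynomial.IsHomogeneous.sum _ _ _ fun j _ => (isHomogeneous_polyComp γ (hP j)).C_mul _

theorem isTwoHomogeneous_conj (γ : GL (Fin n) ℝ) {Q : VectorField n}
    (hQ : ∀ i, IsTwoHomogeneous (Q i)) (i : Fin n) : IsTwoHomogeneous (conj γ Q i) := by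
  obtain ⟨hD, hP⟩ := isHomogeneous_denom_numer hQ
  exact ⟨_, _, _, isHomogeneous_conjNumer γ hP i, isHomogeneous_polyComp γ hD,
    polyComp_ne_zero γ (isReducedForm Q).denom_ne_zero,
    conj_apply_eq_div γ (isReducedForm Q).eq_div i⟩

theorem totalDegree_denom_conj_le (γ : GL (Fin n) ℝ) {Q : VectorField n}
    (hQ : ∀ i, IsTwoHomogeneous (Q i)) :
    (denom (conj γ Q)).totalDegree ≤ (denom Q).totalDegree := by
  obtain ⟨hD, -⟩ := isHomogeneous_denom_numer hQ
  rw [← totalDegree_polyComp γ hD]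
  exact totalDegree_denom_le (polyComp_ne_zero γ (isReducedForm Q).denom_ne_zero)
    (conj_apply_eq_div γ (isReducedForm Q).eq_div)

/-- The denominator of an invariant vector field is semi-invariant, and its numerators are
equivariant with the same multiplier. -/
theorem exists_multiplier_of_conj_eq {γ : GL (Fin n) ℝ} {Q : VectorField n}
    (hQ : ∀ i, IsTwoHomogeneous (Q i)) (h : conj γ Q = Q) :
    ∃ c : ℝ, c ≠ 0 ∧ polyComp γ (denom Q) = MvPolynomial.C c * denom Q ∧
      ∀ i, conjNumer γ (numer Q) i = MvPolynomial.C c * numer Q i := by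
  obtain ⟨hD, -⟩ := isHomogeneous_denom_numer hQ
  have hD0 := (isReducedForm Q).denom_ne_zero
  have hγ0 := polyComp_ne_zero γ hD0
  have hform : ∀ i, Q i = algebraMap (Poly n) (RatFun n) (conjNumer γ (numer Q) i) /
      algebraMap (Poly n) (RatFun n) (polyComp γ (denom Q)) := fun i => by
    rw [← conj_apply_eq_div γ (isReducedForm Q).eq_div i, h]
  obtain ⟨c, hc0, hc⟩ := eq_C_mul_of_dvd_of_totalDegree_le (denom_dvd hγ0 hform) hγ0
    (totalDegree_polyComp γ hD).le
  refine ⟨c, hc0, hc, fun i => ?_⟩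
  have h1 := numer_mul_eq Q hγ0 (hform i)
  rw [hc] at h1
  apply mul_right_cancel₀ hD0
  linear_combination -h1

/-! ### Conjugating superflow fields, and the symmetry -1 -/

theorem conj_smul (γ : GL (Fin n) ℝ) (c : ℝ) (Q : VectorField n) :
    conj γ (c • Q) = c • conj γ Q := by
  funext i
  simp only [conj, Pi.smul_apply, ratComp_smul, Finset.smul_sum]
  exact Finset.sum_congr rfl fun j _ => smul_comm _ _ _

theorem conj_inv_conj (γ : GL (Fin n) ℝ) (Q : VectorField n) : conj γ⁻¹ (conj γ Q) = Q := by
  rw [← conj_mul, mul_inv_cancel, conj_one]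

theorem conj_conj_inv (γ : GL (Fin n) ℝ) (Q : VectorField n) : conj γ (conj γ⁻¹ Q) = Q := by
  rw [← conj_mul, inv_mul_cancel, conj_one]

/-- Competitors are transported back by `h⁻¹`. Conjugation in either direction does not raise the
degree of the denominator, so the strict inequality survives. The group becomes `h⁻¹ Γ h` because
`conj` is a right action. -/
theorem IsSuperflowField.conj {Γ : Subgroup (GL (Fin n) ℝ)} {Q : VectorField n}
    (hQ : IsSuperflowField Γ Q) (h : GL (Fin n) ℝ) :
    IsSuperflowField (Γ.map (MulAut.conj h⁻¹).toMonoidHom) (conj h Q) where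
  finite := by
    have := hQ.finite
    exact Finite.of_surjective _ (Γ.equivMapOfInjective _ (MulAut.conj h⁻¹).injective).surjective
  ne_zero h0 := hQ.ne_zero <| by
    rw [← conj_inv_conj h Q, h0]
    funext i
    simp [Superflow.conj]
  homogeneous := isTwoHomogeneous_conj h hQ.homogeneous
  invariant := by
    rintro _ ⟨γ, hγ, rfl⟩
    have e : h * (h⁻¹ * γ * h) = γ * h := by group
    simp only [MulEquiv.coe_toMonoidHom, MulAut.conj_apply, inv_inv]
    rw [← conj_mul, e, conj_mul, hQ.invariant γ hγ]
  unique Q' hQ' hinv := by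
    rcases hQ.unique (Superflow.conj h⁻¹ Q') (isTwoHomogeneous_conj _ hQ') (fun γ hγ => by
      have h1 := hinv _ ⟨γ, hγ, rfl⟩
      simp only [MulEquiv.coe_toMonoidHom, MulAut.conj_apply, inv_inv] at h1
      have e : h⁻¹ * γ = h⁻¹ * γ * h * h⁻¹ := by group
      rw [← conj_mul, e, conj_mul, h1]) with ⟨c, hc⟩ | hlt
    · refine Or.inl ⟨c, ?_⟩
      rw [← conj_smul, ← hc, conj_conj_inv]
    · exact Or.inr (((totalDegree_denom_conj_le h hQ.homogeneous).trans_lt hlt).trans_le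
        (totalDegree_denom_conj_le _ hQ'))

/-- A superflow field has no nonscalar competitor whose denominator has at most the same degree. -/
theorem IsSuperflowField.exists_smul {Γ : Subgroup (GL (Fin n) ℝ)} {Q : VectorField n}
    (hQ : IsSuperflowField Γ Q) {Q' : VectorField n} (hQ' : ∀ i, IsTwoHomogeneous (Q' i))
    (hinv : ∀ γ ∈ Γ, Superflow.conj γ Q' = Q')
    (hd : (denom Q').totalDegree ≤ (denom Q).totalDegree) : ∃ c : ℝ, Q' = c • Q :=
  (hQ.unique Q' hQ' hinv).resolve_right hd.not_gt

/-- Q(-x) = Q(x) because the degree is even, so only the sign of the outer inverse remains. -/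
theorem conj_neg_one {Q : VectorField n} (hQ : ∀ i, IsTwoHomogeneous (Q i)) :
    conj (-1) Q = -Q := by
  have hs : ∀ p : Poly n, polyComp (-1) p = scale (-1) p := fun p => by
    congr 1
    ext i : 1
    simp [polyComp, scale, Matrix.one_apply]
  obtain ⟨hD, hP⟩ := isHomogeneous_denom_numer hQ
  have hD0 := (isReducedForm Q).denom_ne_zero
  funext i
  have hN : conjNumer (-1) (numer Q) i
      = -(MvPolynomial.C ((-1) ^ (denom Q).totalDegree) * numer Q i) := by
    have h1 : ((-1 : GL (Fin n) ℝ)⁻¹ : GL (Fin n) ℝ) = -1 := by simp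
    simp only [conjNumer, h1, hs, Units.val_neg, Units.val_one, Matrix.neg_apply,
      Matrix.one_apply]
    rw [Finset.sum_eq_single i (by intro j _ hj; simp [hj.symm]) (by simp),
      scale_of_isHomogeneous (hP i), pow_add]
    simp
  rw [conj_apply_eq_div _ (isReducedForm Q).eq_div i, hN, hs, scale_of_isHomogeneous hD,
    Pi.neg_apply, (isReducedForm Q).eq_div i, map_neg, neg_div, map_mul, map_mul,
    mul_div_mul_left _ _ (algebraMap_ne_zero (by simp))]

theorem IsSuperflowField.neg_one_notMem {Γ : Subgroup (GL (Fin n) ℝ)} {Q : VectorField n}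
    (hQ : IsSuperflowField Γ Q) : (-1 : GL (Fin n) ℝ) ∉ Γ := fun h => by
  have h1 := hQ.invariant _ h
  rw [conj_neg_one hQ.homogeneous] at h1
  refine hQ.ne_zero (funext fun i => ?_)
  exact CharZero.neg_eq_self_iff.1 (congrFun h1 i)

end ChangeOfVariables

/-! ### Finite subgroups of `GL(2, ℝ)` -/

open scoped MatrixOrder Matrix in
/-- Every finite subgroup of `GL(n, ℝ)` is conjugate to a group of orthogonal matrices. -/
theorem exists_conj_orthogonal {n : ℕ} (Γ : Subgroup (GL (Fin n) ℝ)) [Finite Γ] :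
    ∃ h : GL (Fin n) ℝ, ∀ γ ∈ Γ,
      ((h * γ * h⁻¹ : GL (Fin n) ℝ) : Matrix (Fin n) (Fin n) ℝ)ᵀ *
        ((h * γ * h⁻¹ : GL (Fin n) ℝ) : Matrix (Fin n) (Fin n) ℝ) = 1 := by
  classical
  have := Fintype.ofFinite Γ
  let M (γ : Γ) : Matrix (Fin n) (Fin n) ℝ := ((γ : GL (Fin n) ℝ) : Matrix (Fin n) (Fin n) ℝ)
  -- The Gram matrix of the averaged inner product, hence Γ-invariant. Any factorization `G = Bᵀ *
  -- B` provides a conjugating matrix `B`.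
  let G : Matrix (Fin n) (Fin n) ℝ := ∑ γ : Γ, (M γ)ᵀ * M γ
  have hpos : ∀ γ : Γ, ((M γ)ᵀ * M γ).PosDef := fun γ => by
    have h1 : Function.Injective (M γ).mulVec :=
      Matrix.mulVec_injective_of_isUnit (Units.isUnit (γ : GL (Fin n) ℝ))
    have h2 := Matrix.PosDef.conjTranspose_mul_self (M γ) h1
    rwa [Matrix.conjTranspose_eq_transpose_of_trivial] at h2
  have hG : G.PosDef := Matrix.posDef_sum ⟨1, Finset.mem_univ 1⟩ fun γ _ => hpos γ
  obtain ⟨B, hB⟩ := CStarAlgebra.nonneg_iff_eq_star_mul_self.mp hG.posSemidef.nonneg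
  rw [Matrix.star_eq_conjTranspose, Matrix.conjTranspose_eq_transpose_of_trivial] at hB
  have hBu : IsUnit B := by
    have h1 := (Matrix.isUnit_iff_isUnit_det _).1 hG.isUnit
    rw [hB, Matrix.det_mul] at h1
    exact (Matrix.isUnit_iff_isUnit_det _).2 (isUnit_of_mul_isUnit_right h1)
  obtain ⟨b, rfl⟩ := hBu
  refine ⟨b, fun γ hγ => ?_⟩
  have hinv : (γ : Matrix (Fin n) (Fin n) ℝ)ᵀ * G * (γ : Matrix (Fin n) (Fin n) ℝ) = G := by
    simp only [G, Finset.mul_sum, Finset.sum_mul]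
    refine Fintype.sum_equiv (Equiv.mulRight ⟨γ, hγ⟩) _ _ fun δ => ?_
    simp [M, Matrix.mul_assoc, Matrix.transpose_mul]
  have hb : (b : Matrix (Fin n) (Fin n) ℝ) * ((b⁻¹ : GL (Fin n) ℝ) : Matrix _ _ ℝ) = 1 :=
    b.mul_inv
  have hb' : ((b⁻¹ : GL (Fin n) ℝ) : Matrix _ _ ℝ)ᵀ * (b : Matrix (Fin n) (Fin n) ℝ)ᵀ = 1 := by
    rw [← Matrix.transpose_mul, hb, Matrix.transpose_one]
  rw [hB] at hinv
  simp only [Units.val_mul, Matrix.transpose_mul]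
  set B : Matrix (Fin n) (Fin n) ℝ := (b : Matrix (Fin n) (Fin n) ℝ)
  set B' : Matrix (Fin n) (Fin n) ℝ := ((b⁻¹ : GL (Fin n) ℝ) : Matrix (Fin n) (Fin n) ℝ)
  set g : Matrix (Fin n) (Fin n) ℝ := (γ : Matrix (Fin n) (Fin n) ℝ)
  calc B'ᵀ * (gᵀ * Bᵀ) * (B * g * B') = B'ᵀ * (gᵀ * (Bᵀ * B) * g) * B' := by
        simp only [Matrix.mul_assoc]
    _ = (B'ᵀ * Bᵀ) * (B * B') := by
      rw [hinv]; simp only [Matrix.mul_assoc]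
    _ = 1 := by rw [hb, hb', one_mul]

/-- Multiplication by `z ∈ ℂ` as a real matrix. -/
def complexMatrix : ℂ →* Matrix (Fin 2) (Fin 2) ℝ where
  toFun z := !![z.re, -z.im; z.im, z.re]
  map_one' := by ext i j; fin_cases i <;> fin_cases j <;> simp
  map_mul' z w := by
    ext i j
    fin_cases i <;> fin_cases j <;> simp [Matrix.mul_apply, Fin.sum_univ_two] <;> ring

/-- The rotation of the plane by a unit complex number. -/
def rot : Circle →* GL (Fin 2) ℝ := (complexMatrix.comp Circle.coeHom).toHomUnits

theorem coe_rot (z : Circle) :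
    (rot z : Matrix (Fin 2) (Fin 2) ℝ) = !![(z : ℂ).re, -(z : ℂ).im; (z : ℂ).im, (z : ℂ).re] :=
  rfl

theorem rot_injective : Function.Injective rot := fun z w h => by
  have h1 : (rot z : Matrix (Fin 2) (Fin 2) ℝ) = rot w := by rw [h]
  rw [coe_rot, coe_rot] at h1
  exact Circle.ext (Complex.ext (by simpa using congrFun₂ h1 0 0) (by simpa using congrFun₂ h1 1 0))

/-- The reflection of the plane in the first coordinate axis. -/
def flip : GL (Fin 2) ℝ :=
  ⟨!![1, 0; 0, -1], !![1, 0; 0, -1],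
    by ext i j; fin_cases i <;> fin_cases j <;> simp,
    by ext i j; fin_cases i <;> fin_cases j <;> simp⟩

theorem coe_flip : (flip : Matrix (Fin 2) (Fin 2) ℝ) = !![1, 0; 0, -1] := rfl

theorem flip_mul_flip : flip * flip = 1 := Units.ext flip.mul_inv

theorem flip_inv : flip⁻¹ = flip := rfl

theorem rot_mul_flip (z : Circle) : rot z * flip = flip * rot z⁻¹ := by
  ext i j
  simp only [Units.val_mul, coe_rot, coe_flip, Circle.coe_inv_eq_conj]
  fin_cases i <;> fin_cases j <;> simp

theorem rot_ne_rot_mul_flip (z w : Circle) : rot z ≠ rot w * flip := fun h => by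
  have h1 : (rot z : Matrix (Fin 2) (Fin 2) ℝ) = rot w * flip := by rw [h, Units.val_mul]
  have h2 := congrArg Matrix.det h1
  have hz : ∀ z : Circle, (z : ℂ).re * (z : ℂ).re + (z : ℂ).im * (z : ℂ).im = 1 := fun z => by
    have := Circle.normSq_coe z
    rwa [Complex.normSq_apply] at this
  rw [Matrix.det_mul, coe_rot, coe_rot, coe_flip] at h2
  simp [Matrix.det_fin_two_of] at h2
  linarith [hz z, hz w]

open scoped Matrix in
theorem exists_eq_rot_or_eq_rot_mul_flip {γ : GL (Fin 2) ℝ}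
    (h : (γ : Matrix (Fin 2) (Fin 2) ℝ)ᵀ * (γ : Matrix (Fin 2) (Fin 2) ℝ) = 1) :
    ∃ z, γ = rot z ∨ γ = rot z * flip := by
  have h00 := congrFun₂ h 0 0
  have h01 := congrFun₂ h 0 1
  have h11 := congrFun₂ h 1 1
  simp only [Matrix.mul_apply, Fin.sum_univ_two, Matrix.transpose_apply, Matrix.one_apply] at h00 h01 h11
  simp only [↓reduceIte, zero_ne_one] at h00 h01 h11
  obtain ⟨z, hz⟩ : ∃ z : Circle, (z : ℂ) = ⟨γ 0 0, γ 1 0⟩ := by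
    refine ⟨⟨⟨γ 0 0, γ 1 0⟩, mem_sphere_zero_iff_norm.2 ?_⟩, rfl⟩
    rw [← Real.sqrt_one, ← h00]
    rfl
  -- det² = 1, as the Gram determinant of the columns.
  have hdet : (γ 0 0 * γ 1 1 - γ 0 1 * γ 1 0 - 1) * (γ 0 0 * γ 1 1 - γ 0 1 * γ 1 0 + 1) = 0 := by
    linear_combination h11 + (γ 0 1 * γ 0 1 + γ 1 1 * γ 1 1) * h00
      - (γ 0 0 * γ 0 1 + γ 1 0 * γ 1 1) * h01
  refine ⟨z, ?_⟩
  rcases mul_eq_zero.1 hdet with hd | hd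
  · left
    -- Writing a, b, c, d for the entries, (a - d)² + (b + c)² is the sum of the squared column
    -- lengths minus twice the determinant, that is, 2 - 2 = 0.
    have e1 : γ 0 0 - γ 1 1 = 0 := by
      refine pow_eq_zero_iff two_ne_zero |>.1 (le_antisymm ?_ (sq_nonneg _))
      nlinarith [sq_nonneg (γ 0 1 + γ 1 0)]
    have e2 : γ 0 1 + γ 1 0 = 0 := by
      refine pow_eq_zero_iff two_ne_zero |>.1 (le_antisymm ?_ (sq_nonneg _))
      nlinarith [sq_nonneg (γ 0 0 - γ 1 1)]
    refine Units.ext (Matrix.ext fun i j => ?_)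
    rw [coe_rot, hz]
    fin_cases i <;> fin_cases j <;> simp <;> linarith
  · right
    have e1 : γ 0 0 + γ 1 1 = 0 := by
      refine pow_eq_zero_iff two_ne_zero |>.1 (le_antisymm ?_ (sq_nonneg _))
      nlinarith [sq_nonneg (γ 0 1 - γ 1 0)]
    have e2 : γ 0 1 - γ 1 0 = 0 := by
      refine pow_eq_zero_iff two_ne_zero |>.1 (le_antisymm ?_ (sq_nonneg _))
      nlinarith [sq_nonneg (γ 0 0 + γ 1 1)]
    refine Units.ext (Matrix.ext fun i j => ?_)
    rw [Units.val_mul, coe_rot, coe_flip, hz]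
    fin_cases i <;> fin_cases j <;> simp <;> linarith

/-- By Lagrange `C` lies in the group of roots of unity of order dividing its cardinality, and that
group has exactly as many elements. -/
theorem mem_iff_pow_card_eq_one (C : Subgroup Circle) [Finite C] (z : Circle) :
    z ∈ C ↔ z ^ Nat.card C = 1 := by
  have hinj : Function.Injective Circle.toUnits := fun z w h => by
    apply Circle.ext
    simpa using congrArg Units.val h
  have hpos : NeZero (Nat.card C) := ⟨Nat.card_pos.ne'⟩
  have hle : C.map Circle.toUnits ≤ rootsOfUnity (Nat.card C) ℂ := by
    rintro _ ⟨w, hw, rfl⟩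
    have h1 : w ^ Nat.card C = 1 := congrArg Subtype.val (pow_card_eq_one' (x := (⟨w, hw⟩ : C)))
    rw [mem_rootsOfUnity, ← map_pow, h1, map_one]
  have heq : C.map Circle.toUnits = rootsOfUnity (Nat.card C) ℂ := by
    apply Subgroup.eq_of_le_of_card_ge hle
    rw [Subgroup.card_map_of_injective hinj]
    exact card_rootsOfUnity ℂ _
  rw [← Subgroup.mem_map_iff_mem hinj, heq, mem_rootsOfUnity, ← map_pow,
    map_eq_one_iff _ hinj]

/-- The standard representation of the dihedral group. -/
def dihedralHom (M : ℕ) [NeZero M] : DihedralGroup M →* GL (Fin 2) ℝ where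
  toFun
    | .r k => rot (ZMod.toCircle k)
    | .sr k => flip * rot (ZMod.toCircle k)
  map_one' := by
    change rot (ZMod.toCircle 0) = 1
    rw [AddChar.map_zero_eq_one, map_one]
  map_mul' := by
    have h : ∀ z, rot z * flip = flip * rot z⁻¹ := rot_mul_flip
    rintro (i | i) (j | j)
    · simp [AddChar.map_add_eq_mul]
    · simp only [DihedralGroup.r_mul_sr, ← mul_assoc, h, AddChar.map_sub_eq_div, div_eq_mul_inv,
        map_mul]
      rw [mul_assoc, mul_assoc, ← map_mul, ← map_mul, mul_comm]
    · simp [AddChar.map_add_eq_mul, mul_assoc]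
    · simp only [DihedralGroup.sr_mul_sr, AddChar.map_sub_eq_div, div_eq_mul_inv, map_mul]
      rw [mul_assoc, ← mul_assoc (rot _) flip, h, mul_assoc, ← mul_assoc, flip_mul_flip, one_mul,
        ← map_mul, ← map_mul, mul_comm]

theorem dihedralHom_injective (M : ℕ) [NeZero M] : Function.Injective (dihedralHom M) := by
  rintro (i | i) (j | j) h
  · exact congrArg _ (ZMod.injective_toCircle (rot_injective h))
  · refine absurd (h.trans ?_) (rot_ne_rot_mul_flip _ (ZMod.toCircle j)⁻¹)
    rw [rot_mul_flip, inv_inv]; rfl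
  · refine absurd (h.symm.trans ?_) (rot_ne_rot_mul_flip _ (ZMod.toCircle i)⁻¹)
    rw [rot_mul_flip, inv_inv]; rfl
  · exact congrArg _ (ZMod.injective_toCircle (rot_injective (mul_left_cancel h)))

/-- The standard dihedral group of order `2 M` in `GL(2, ℝ)`. -/
def dihedral (M : ℕ) [NeZero M] : Subgroup (GL (Fin 2) ℝ) := (dihedralHom M).range

/-- `dihedral M` is isomorphic to the abstract dihedral group. -/
def dihedralEquiv (M : ℕ) [NeZero M] : DihedralGroup M ≃* dihedral M :=
  MonoidHom.ofInjective (dihedralHom_injective M)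

instance (M : ℕ) [NeZero M] : Finite (dihedral M) :=
  Finite.of_surjective _ (dihedralEquiv M).surjective

theorem pow_eq_one_iff_exists_toCircle (M : ℕ) [NeZero M] (z : Circle) :
    z ^ M = 1 ↔ ∃ k : ZMod M, ZMod.toCircle k = z := by
  let f : Multiplicative (ZMod M) →* Circle := ZMod.toCircle.toMonoidHom
  have hf : Function.Injective f := fun a b h => ZMod.injective_toCircle h
  have e := MonoidHom.ofInjective hf
  have : Finite f.range := Finite.of_surjective _ e.surjective
  have hc : Nat.card f.range = M := by
    rw [← Nat.card_congr e.toEquiv]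
    exact Nat.card_zmod M
  have h := mem_iff_pow_card_eq_one f.range z
  rw [hc] at h
  rw [← h]
  exact Iff.rfl

theorem mem_dihedral {M : ℕ} [NeZero M] {γ : GL (Fin 2) ℝ} :
    γ ∈ dihedral M ↔ ∃ z : Circle, z ^ M = 1 ∧ (γ = rot z ∨ γ = rot z * flip) := by
  constructor
  · rintro ⟨k | k, rfl⟩
    · exact ⟨_, (pow_eq_one_iff_exists_toCircle M _).2 ⟨k, rfl⟩, Or.inl rfl⟩
    · refine ⟨_, (pow_eq_one_iff_exists_toCircle M _).2 ⟨-k, rfl⟩, Or.inr ?_⟩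
      rw [rot_mul_flip, AddChar.map_neg_eq_inv, inv_inv]; rfl
  · rintro ⟨z, hz, rfl | rfl⟩
    · obtain ⟨k, rfl⟩ := (pow_eq_one_iff_exists_toCircle M z).1 hz
      exact ⟨.r k, rfl⟩
    · obtain ⟨k, rfl⟩ := (pow_eq_one_iff_exists_toCircle M z).1 hz
      refine ⟨.sr (-k), ?_⟩
      rw [rot_mul_flip, ← AddChar.map_neg_eq_inv]; rfl

/-- Up to conjugation, a finite subgroup of `GL(2, ℝ)` consists of rotations or is a standard
dihedral group. -/
theorem exists_conj_rotations_or_dihedral (Γ : Subgroup (GL (Fin 2) ℝ)) [Finite Γ] :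
    ∃ h : GL (Fin 2) ℝ, (∀ γ ∈ Γ.map (MulAut.conj h).toMonoidHom, ∃ z, γ = rot z) ∨
      ∃ (M : ℕ) (_ : NeZero M), Γ.map (MulAut.conj h).toMonoidHom = dihedral M := by
  obtain ⟨h, hh⟩ := exists_conj_orthogonal Γ
  have hO : ∀ γ ∈ Γ, ∃ z, h * γ * h⁻¹ = rot z ∨ h * γ * h⁻¹ = rot z * flip :=
    fun γ hγ => exists_eq_rot_or_eq_rot_mul_flip (hh γ hγ)
  by_cases hrefl : ∃ γ ∈ Γ, ∃ z, h * γ * h⁻¹ = rot z * flip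
  · obtain ⟨σ, hσ, w, hw⟩ := hrefl
    -- Turning by half the angle of `w` moves the mirror line of the reflection onto the first axis,
    -- so that the reflection becomes `flip`.
    obtain ⟨u, hu⟩ : ∃ u : Circle, u * u = w := by
      refine ⟨Circle.exp (Complex.arg w / 2), ?_⟩
      rw [← Circle.exp_add, add_halves, Circle.exp_arg]
    let g := rot u⁻¹ * h
    let Γ' := Γ.map (MulAut.conj g).toMonoidHom
    have hΓ' : ∀ γ ∈ Γ, g * γ * g⁻¹ ∈ Γ' := fun γ hγ => ⟨γ, hγ, rfl⟩
    have hgσ : g * σ * g⁻¹ = flip := by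
      have e : g * σ * g⁻¹ = rot u⁻¹ * (h * σ * h⁻¹) * rot u := by
        simp only [g, mul_inv_rev, ← map_inv, inv_inv]; group
      rw [e, hw, ← hu, mul_assoc, mul_assoc, ← inv_inv u, ← rot_mul_flip, ← mul_assoc, ← mul_assoc,
        ← map_mul, ← map_mul]
      simp
    have hflip : flip ∈ Γ' := hgσ ▸ hΓ' σ hσ
    have hform : ∀ γ ∈ Γ', ∃ z, γ = rot z ∨ γ = rot z * flip := by
      rintro _ ⟨γ, hγ, rfl⟩
      obtain ⟨z, hz⟩ := hO γ hγ
      have e : g * γ * g⁻¹ = rot u⁻¹ * (h * γ * h⁻¹) * rot u := by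
        simp only [g, mul_inv_rev, ← map_inv, inv_inv]; group
      change ∃ z, g * γ * g⁻¹ = rot z ∨ g * γ * g⁻¹ = rot z * flip
      rw [e]
      rcases hz with hz | hz
      · exact ⟨u⁻¹ * z * u, Or.inl (by rw [hz, map_mul, map_mul])⟩
      · refine ⟨u⁻¹ * z * u⁻¹, Or.inr ?_⟩
        rw [hz, map_mul, map_mul, mul_assoc _ _ flip, rot_mul_flip u⁻¹, inv_inv]
        simp only [mul_assoc]
    have : Finite Γ' :=
      Finite.of_surjective _ (Γ.equivMapOfInjective _ (MulAut.conj g).injective).surjective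
    -- The rotations in `Γ'`. Multiplying by `flip` reduces membership of every reflection to
    -- membership of a rotation.
    let C := Γ'.comap rot
    have : Finite C := Finite.of_injective (fun z : C => (⟨rot z, z.2⟩ : Γ')) fun z w hzw =>
      Subtype.ext (rot_injective (congrArg Subtype.val hzw))
    have : NeZero (Nat.card C) := ⟨Nat.card_pos.ne'⟩
    refine ⟨g, Or.inr ⟨Nat.card C, inferInstance, ?_⟩⟩
    ext γ
    rw [mem_dihedral]
    constructor
    · intro hγ
      obtain ⟨z, rfl | rfl⟩ := hform γ hγ
      · exact ⟨z, (mem_iff_pow_card_eq_one C z).1 hγ, Or.inl rfl⟩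
      · refine ⟨z, (mem_iff_pow_card_eq_one C z).1 ?_, Or.inr rfl⟩
        have h1 := Γ'.mul_mem hγ hflip
        rwa [mul_assoc, flip_mul_flip, mul_one] at h1
    · rintro ⟨z, hz, rfl | rfl⟩
      · exact (mem_iff_pow_card_eq_one C z).2 hz
      · exact Γ'.mul_mem ((mem_iff_pow_card_eq_one C z).2 hz) hflip
  · refine ⟨h, Or.inl ?_⟩
    rintro _ ⟨γ, hγ, rfl⟩
    obtain ⟨z, hz | hz⟩ := hO γ hγ
    · exact ⟨z, hz⟩
    · exact absurd ⟨γ, hγ, z, hz⟩ hrefl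

/-! ### Groups without superflows -/

/-- The polynomial vector field with components `P`. -/
def polyField {n : ℕ} (P : Fin n → Poly n) : VectorField n :=
  fun i => algebraMap (Poly n) (RatFun n) (P i)

theorem isTwoHomogeneous_polyField {n : ℕ} {P : Fin n → Poly n}
    (hP : ∀ i, (P i).IsHomogeneous 2) (i : Fin n) : IsTwoHomogeneous (polyField P i) :=
  ⟨0, P i, 1, hP i, MvPolynomial.isHomogeneous_one _ _, one_ne_zero, by simp [polyField]⟩

theorem totalDegree_denom_polyField {n : ℕ} (P : Fin n → Poly n) :
    (denom (polyField P)).totalDegree = 0 := by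
  have h := totalDegree_denom_le (Q := polyField P) (p := P) one_ne_zero
    (fun i => by simp [polyField])
  simpa using h

theorem conj_polyField {n : ℕ} (γ : GL (Fin n) ℝ) (P : Fin n → Poly n) :
    conj γ (polyField P) = polyField (conjNumer γ P) := by
  funext i
  rw [conj_apply_eq_div γ (D := 1) (P := P) (fun i => by simp [polyField])]
  simp [polyField]

/-- The competitor is `Q` followed by a quarter turn, which commutes with all rotations. It has no
larger a denominator, and it cannot be a real multiple of `Q` because a quarter turn has no real
eigenvalue. -/
theorem not_isSuperflowField_of_forall_rot {Γ : Subgroup (GL (Fin 2) ℝ)}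
    (hΓ : ∀ γ ∈ Γ, ∃ z, γ = rot z) (Q : VectorField 2) : ¬ IsSuperflowField Γ Q := fun hQ => by
  obtain ⟨hD, hP⟩ := isHomogeneous_denom_numer hQ.homogeneous
  have hD0 := (isReducedForm Q).denom_ne_zero
  have hform : ∀ i, (![-Q 1, Q 0] : VectorField 2) i =
      algebraMap (Poly 2) (RatFun 2) ((![-numer Q 1, numer Q 0] : Fin 2 → Poly 2) i) /
        algebraMap (Poly 2) (RatFun 2) (denom Q) := by
    intro i
    fin_cases i <;> simp [(isReducedForm Q).eq_div, neg_div]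
  obtain ⟨c, hc⟩ := hQ.exists_smul (Q' := ![-Q 1, Q 0]) (fun i => by
      refine ⟨_, _, _, ?_, hD, hD0, hform i⟩
      fin_cases i
      exacts [(hP 1).neg, hP 0]) (fun γ hγ => by
      obtain ⟨z, rfl⟩ := hΓ γ hγ
      have h := hQ.invariant _ hγ
      have h0 := congrFun h 0
      have h1 := congrFun h 1
      simp only [Superflow.conj, Fin.sum_univ_two, ← map_inv, coe_rot] at h0 h1
      simp only [Matrix.of_apply, Matrix.cons_val', Matrix.cons_val_zero, Matrix.cons_val_one,
        Matrix.cons_val_fin_one] at h0 h1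
      funext i
      simp only [Superflow.conj, Fin.sum_univ_two, ← map_inv, coe_rot]
      fin_cases i
      · simp only [Fin.zero_eta, Matrix.of_apply, Matrix.cons_val', Matrix.cons_val_zero,
          Matrix.cons_val_one, Matrix.cons_val_fin_one, map_neg, smul_neg]
        conv_rhs => rw [← h1]
        simp only [neg_smul]
        abel
      · simp only [Fin.mk_one, Matrix.of_apply, Matrix.cons_val', Matrix.cons_val_zero,
          Matrix.cons_val_one, Matrix.cons_val_fin_one, map_neg, smul_neg]
        conv_rhs => rw [← h0]
        simp only [neg_smul]
        abel) (totalDegree_denom_le hD0 hform)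
  have h0 : -Q 1 = c • Q 0 := congrFun hc 0
  have h1 : Q 0 = c • Q 1 := congrFun hc 1
  have h2 : (1 + c * c) • Q 1 = 0 := by
    rw [add_smul, one_smul, mul_smul, ← h1, ← h0, add_neg_cancel]
  have h3 : Q 1 = 0 := (smul_eq_zero.1 h2).resolve_left
    (add_pos_of_pos_of_nonneg one_pos (mul_self_nonneg c)).ne'
  apply hQ.ne_zero
  funext i
  fin_cases i
  · change Q 0 = 0
    rw [h1, h3, smul_zero]
  · exact h3

theorem IsSuperflowField.exists_smul_polyField {n : ℕ} {Γ : Subgroup (GL (Fin n) ℝ)}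
    {Q : VectorField n} (hQ : IsSuperflowField Γ Q) {P : Fin n → Poly n}
    (hP : ∀ i, (P i).IsHomogeneous 2) (hinv : ∀ γ ∈ Γ, conjNumer γ P = P) :
    ∃ c : ℝ, polyField P = c • Q :=
  hQ.exists_smul (isTwoHomogeneous_polyField hP)
    (fun γ hγ => by rw [conj_polyField, hinv γ hγ])
    (by rw [totalDegree_denom_polyField]; exact Nat.zero_le _)

theorem conjNumer_one {n : ℕ} (P : Fin n → Poly n) : conjNumer 1 P = P := by
  funext i
  simp [conjNumer, polyComp_one, Matrix.one_apply]

/-- The quadratic fields (x², 0) and (0, xy) are both invariant under the reflection. Having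
constant denominators, both would have to be multiples of `Q`. -/
theorem not_isSuperflowField_dihedral_one (Q : VectorField 2) :
    ¬ IsSuperflowField (dihedral 1) Q := fun hQ => by
  have hinv : ∀ P : Fin 2 → Poly 2, conjNumer flip P = P → ∀ γ ∈ dihedral 1, conjNumer γ P = P := by
    intro P hP γ hγ
    obtain ⟨z, hz, hγ⟩ := mem_dihedral.1 hγ
    rw [pow_one] at hz
    subst hz
    rw [map_one, one_mul] at hγ
    rcases hγ with rfl | rfl
    exacts [conjNumer_one P, hP]
  obtain ⟨c, hc⟩ := hQ.exists_smul_polyField (P := ![MvPolynomial.X 0 ^ 2, 0]) (fun i => by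
      fin_cases i
      exacts [MvPolynomial.isHomogeneous_X_pow _ _, MvPolynomial.isHomogeneous_zero _ _ _])
    (hinv _ (by
      funext i
      fin_cases i <;> simp [conjNumer, flip_inv, coe_flip, polyComp]))
  obtain ⟨c', hc'⟩ := hQ.exists_smul_polyField
    (P := ![0, MvPolynomial.X 0 * MvPolynomial.X 1]) (fun i => by
      fin_cases i
      exacts [MvPolynomial.isHomogeneous_zero _ _ _,
        (MvPolynomial.isHomogeneous_X _ _).mul (MvPolynomial.isHomogeneous_X _ _)])
    (hinv _ (by
      funext i
      fin_cases i <;> simp [conjNumer, flip_inv, coe_flip, polyComp]))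
  have h0 : algebraMap (Poly 2) (RatFun 2) (MvPolynomial.X 0 ^ 2) = c • Q 0 := congrFun hc 0
  have h1 : algebraMap (Poly 2) (RatFun 2) 0 = c • Q 1 := congrFun hc 1
  have h2 : algebraMap (Poly 2) (RatFun 2) (MvPolynomial.X 0 * MvPolynomial.X 1) = c' • Q 1 :=
    congrFun hc' 1
  have hX : ∀ i : Fin 2, (MvPolynomial.X i : Poly 2) ≠ 0 := fun i => MvPolynomial.X_ne_zero i
  have hc0 : c ≠ 0 := by
    rintro rfl
    rw [zero_smul] at h0
    exact algebraMap_ne_zero (pow_ne_zero 2 (hX 0)) h0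
  have hQ1 : Q 1 = 0 := by
    rw [map_zero] at h1
    exact (smul_eq_zero.1 h1.symm).resolve_left hc0
  rw [hQ1, smul_zero] at h2
  exact algebraMap_ne_zero (mul_ne_zero (hX 0) (hX 1)) h2

theorem neg_one_mem_dihedral {M : ℕ} [NeZero M] (hM : Even M) : (-1 : GL (Fin 2) ℝ) ∈ dihedral M := by
  refine mem_dihedral.2 ⟨-1, ?_, Or.inl ?_⟩
  · apply Circle.ext
    simp [hM.neg_one_pow]
  · refine Units.ext (Matrix.ext fun i j => ?_)
    rw [coe_rot]
    fin_cases i <;> fin_cases j <;> simp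

/-- A group with a superflow is conjugate to a standard dihedral group of order `2 M` with odd
`M ≥ 3`. -/
theorem IsSuperflowField.exists_conj_eq_dihedral {Γ : Subgroup (GL (Fin 2) ℝ)} {Q : VectorField 2}
    (hQ : IsSuperflowField Γ Q) : ∃ (h : GL (Fin 2) ℝ) (d : ℕ), 1 ≤ d ∧
      Γ.map (MulAut.conj h).toMonoidHom = dihedral (2 * d + 1) := by
  have := hQ.finite
  obtain ⟨h, hΓ⟩ := exists_conj_rotations_or_dihedral Γ
  have hQ' := hQ.conj h⁻¹
  rw [inv_inv] at hQ'
  rcases hΓ with hΓ | ⟨M, hM, hΓ⟩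
  · exact absurd hQ' (not_isSuperflowField_of_forall_rot hΓ _)
  · rw [hΓ] at hQ'
    rcases Nat.even_or_odd' M with ⟨k, rfl | rfl⟩
    · exact absurd (neg_one_mem_dihedral (even_two_mul k)) hQ'.neg_one_notMem
    · rcases Nat.eq_zero_or_pos k with rfl | hk
      · exact absurd hQ' (not_isSuperflowField_dihedral_one _)
      · exact ⟨h, k, hk, hΓ⟩

section Dihedral

open ComplexConjugate

/-! ### The superflow field of an odd dihedral group -/

/-- The point of `ℂ` with real coordinates `x`. -/
def toComplex (x : Fin 2 → ℝ) : ℂ := ⟨x 0, x 1⟩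

/-- The real and the imaginary part of `conj z ^ k` as polynomials in the coordinates of `z`. -/
def conjPow : ℕ → Fin 2 → Poly 2
  | 0 => ![1, 0]
  | k + 1 => ![MvPolynomial.X 0 * conjPow k 0 + MvPolynomial.X 1 * conjPow k 1,
      MvPolynomial.X 0 * conjPow k 1 - MvPolynomial.X 1 * conjPow k 0]

theorem isHomogeneous_conjPow (k : ℕ) (i : Fin 2) : (conjPow k i).IsHomogeneous k := by
  have hX : ∀ j : Fin 2, (MvPolynomial.X j : Poly 2).IsHomogeneous 1 :=
    MvPolynomial.isHomogeneous_X ℝ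
  induction k generalizing i with
  | zero =>
    fin_cases i
    exacts [MvPolynomial.isHomogeneous_one _ _, MvPolynomial.isHomogeneous_zero _ _ _]
  | succ k ih =>
    have h : ∀ i, (conjPow (k + 1) i).IsHomogeneous (1 + k) := Fin.forall_fin_two.2
      ⟨((hX 0).mul (ih 0)).add ((hX 1).mul (ih 1)),
        ((hX 0).mul (ih 1)).sub ((hX 1).mul (ih 0))⟩
    rw [add_comm 1 k] at h
    exact h i

/-- The complex value of a pair of polynomials. -/
def evalComplex (P : Fin 2 → Poly 2) (x : Fin 2 → ℝ) : ℂ :=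
  ⟨MvPolynomial.eval x (P 0), MvPolynomial.eval x (P 1)⟩

theorem evalComplex_conjPow (k : ℕ) (x : Fin 2 → ℝ) :
    evalComplex (conjPow k) x = conj (toComplex x) ^ k := by
  induction k with
  | zero => apply Complex.ext <;> simp [evalComplex, conjPow]
  | succ k ih =>
    rw [pow_succ, ← ih]
    apply Complex.ext <;> simp [evalComplex, conjPow, toComplex] <;> ring

theorem evalComplex_injective {P P' : Fin 2 → Poly 2}
    (h : ∀ x, evalComplex P x = evalComplex P' x) : P = P' := by
  funext i
  apply MvPolynomial.funext
  intro x
  have h0 := congrArg Complex.re (h x)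
  have h1 := congrArg Complex.im (h x)
  fin_cases i
  exacts [h0, h1]

theorem toComplex_rot_mulVec (z : Circle) (x : Fin 2 → ℝ) :
    toComplex ((rot z : Matrix (Fin 2) (Fin 2) ℝ).mulVec x) = z * toComplex x := by
  rw [coe_rot]
  apply Complex.ext <;> simp [toComplex, Matrix.mulVec, dotProduct, Fin.sum_univ_two] <;> ring

theorem toComplex_flip_mulVec (x : Fin 2 → ℝ) :
    toComplex ((flip : Matrix (Fin 2) (Fin 2) ℝ).mulVec x) = conj (toComplex x) := by
  rw [coe_flip]
  apply Complex.ext <;> simp [toComplex, Matrix.mulVec, dotProduct, Fin.sum_univ_two]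

theorem evalComplex_conjNumer_rot (z : Circle) (P : Fin 2 → Poly 2) (x : Fin 2 → ℝ) :
    evalComplex (conjNumer (rot z) P) x =
      conj (z : ℂ) * evalComplex P ((rot z : Matrix (Fin 2) (Fin 2) ℝ).mulVec x) := by
  have hinv : (rot z)⁻¹ = rot z⁻¹ := (map_inv rot z).symm
  simp only [evalComplex, conjNumer, hinv, Fin.sum_univ_two, map_add, map_mul, eval_polyComp,
    MvPolynomial.eval_C, coe_rot z⁻¹, Circle.coe_inv_eq_conj]
  apply Complex.ext
  · simp
  · simp
    ring

theorem evalComplex_conjNumer_flip (P : Fin 2 → Poly 2) (x : Fin 2 → ℝ) :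
    evalComplex (conjNumer flip P) x =
      conj (evalComplex P ((flip : Matrix (Fin 2) (Fin 2) ℝ).mulVec x)) := by
  apply Complex.ext <;>
    simp [evalComplex, conjNumer, Fin.sum_univ_two, eval_polyComp, flip_inv, coe_flip]

/-- The polynomial `x² + y²`. -/
def normSqPoly : Poly 2 := MvPolynomial.X 0 ^ 2 + MvPolynomial.X 1 ^ 2

theorem eval_normSqPoly (x : Fin 2 → ℝ) :
    MvPolynomial.eval x normSqPoly = Complex.normSq (toComplex x) := by
  simp [normSqPoly, toComplex, Complex.normSq_apply, pow_two]

theorem normSqPoly_pow_ne_zero (e : ℕ) : normSqPoly ^ e ≠ 0 := by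
  refine pow_ne_zero _ fun h => ?_
  have h1 := congrArg (MvPolynomial.eval ![1, 0]) h
  simp [normSqPoly] at h1

theorem isHomogeneous_normSqPoly_pow (e : ℕ) : (normSqPoly ^ e).IsHomogeneous (2 * e) :=
  ((MvPolynomial.isHomogeneous_X_pow _ _).add (MvPolynomial.isHomogeneous_X_pow _ _)).pow e

theorem polyComp_normSqPoly {γ : GL (Fin 2) ℝ} (h : ∀ x, Complex.normSq (toComplex
      ((γ : Matrix (Fin 2) (Fin 2) ℝ).mulVec x)) = Complex.normSq (toComplex x)) (e : ℕ) :
    polyComp γ (normSqPoly ^ e) = normSqPoly ^ e := by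
  apply MvPolynomial.funext
  intro x
  simp only [eval_polyComp, map_pow, eval_normSqPoly, h]

/-- The vector field `conj z ^ (2 e + 2) / |z| ^ (2 e)` of the plane. -/
def dihedralField (e : ℕ) : VectorField 2 := fun i =>
  algebraMap (Poly 2) (RatFun 2) (conjPow (2 * e + 2) i) /
    algebraMap (Poly 2) (RatFun 2) (normSqPoly ^ e)

theorem isTwoHomogeneous_dihedralField (e : ℕ) (i : Fin 2) :
    IsTwoHomogeneous (dihedralField e i) :=
  ⟨2 * e, _, _, isHomogeneous_conjPow _ i, isHomogeneous_normSqPoly_pow e,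
    normSqPoly_pow_ne_zero e, rfl⟩

theorem totalDegree_denom_dihedralField_le (e : ℕ) :
    (denom (dihedralField e)).totalDegree ≤ 2 * e :=
  (totalDegree_denom_le (normSqPoly_pow_ne_zero e) fun _ => rfl).trans
    (isHomogeneous_normSqPoly_pow e).totalDegree_le

theorem dihedralField_ne_zero (e : ℕ) : dihedralField e ≠ 0 := fun h => by
  have h0 : conjPow (2 * e + 2) 0 ≠ 0 := fun h0 => by
    have h1 := congrArg Complex.re (evalComplex_conjPow (2 * e + 2) ![1, 0])
    have h2 : conj (toComplex ![1, 0]) = 1 := by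
      apply Complex.ext <;> simp [toComplex]
    rw [h2, one_pow] at h1
    simp [evalComplex, h0] at h1
  exact div_ne_zero (algebraMap_ne_zero h0) (algebraMap_ne_zero (normSqPoly_pow_ne_zero e))
    (congrFun h 0)

theorem conj_dihedralField_of_eq {γ : GL (Fin 2) ℝ} {e : ℕ}
    (hP : conjNumer γ (conjPow (2 * e + 2)) = conjPow (2 * e + 2))
    (hN : ∀ x, Complex.normSq (toComplex ((γ : Matrix (Fin 2) (Fin 2) ℝ).mulVec x))
      = Complex.normSq (toComplex x)) :
    Superflow.conj γ (dihedralField e) = dihedralField e := by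
  funext i
  have h := conj_apply_eq_div γ (Q := dihedralField e) (fun _ => rfl) i
  rw [h, hP, polyComp_normSqPoly hN]
  rfl

theorem conj_rot_dihedralField {e : ℕ} {z : Circle} (hz : z ^ (2 * e + 3) = 1) :
    Superflow.conj (rot z) (dihedralField e) = dihedralField e := by
  refine conj_dihedralField_of_eq (evalComplex_injective fun x => ?_) fun x => ?_
  -- The numerator supplies `2 e + 2` factors z̄ and the outer inverse rotation one more.
  · have h1 : conj (z : ℂ) ^ (2 * e + 3) = 1 := by
      rw [← map_pow, ← Circle.coe_pow, hz]; simp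
    rw [evalComplex_conjNumer_rot, evalComplex_conjPow, evalComplex_conjPow,
      toComplex_rot_mulVec, map_mul, mul_pow, ← mul_assoc, ← pow_succ', h1, one_mul]
  · rw [toComplex_rot_mulVec, map_mul, Circle.normSq_coe, one_mul]

theorem conj_flip_dihedralField (e : ℕ) :
    Superflow.conj flip (dihedralField e) = dihedralField e := by
  refine conj_dihedralField_of_eq (evalComplex_injective fun x => ?_) fun x => ?_
  · rw [evalComplex_conjNumer_flip, evalComplex_conjPow, evalComplex_conjPow,
      toComplex_flip_mulVec, map_pow, Complex.conj_conj]
  · rw [toComplex_flip_mulVec, Complex.normSq_conj]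

theorem conj_dihedralField {e : ℕ} {γ : GL (Fin 2) ℝ} (hγ : γ ∈ dihedral (2 * e + 3)) :
    Superflow.conj γ (dihedralField e) = dihedralField e := by
  obtain ⟨z, hz, rfl | rfl⟩ := mem_dihedral.1 hγ
  · exact conj_rot_dihedralField hz
  · rw [conj_mul, conj_rot_dihedralField hz, conj_flip_dihedralField]

/-! ### Polynomials in `z` and `conj z` -/

/-- A real polynomial in `x, y` as a complex polynomial in `z, conj z`. -/
def complexify : Poly 2 →ₐ[ℝ] MvPolynomial (Fin 2) ℂ :=
  MvPolynomial.aeval ![MvPolynomial.C (1 / 2) * (MvPolynomial.X 0 + MvPolynomial.X 1),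
    MvPolynomial.C (-Complex.I / 2) * (MvPolynomial.X 0 - MvPolynomial.X 1)]

theorem eval_complexify (p : Poly 2) (x : Fin 2 → ℝ) :
    MvPolynomial.eval ![toComplex x, conj (toComplex x)] (complexify p)
      = (MvPolynomial.eval x p : ℝ) := by
  induction p using MvPolynomial.induction_on with
  | C a => simp [complexify, IsScalarTower.algebraMap_apply ℝ ℂ (MvPolynomial (Fin 2) ℂ)]
  | add p q hp hq => simp [hp, hq]
  | mul_X p i hp =>
    rw [map_mul, map_mul, hp, map_mul, Complex.ofReal_mul]
    congr 1
    fin_cases i <;> apply Complex.ext <;> simp [complexify, toComplex] <;> ring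

theorem complexify_ne_zero {p : Poly 2} (hp : p ≠ 0) : complexify p ≠ 0 := by
  rintro h
  refine hp (MvPolynomial.funext fun x => ?_)
  have h1 := eval_complexify p x
  rw [h, map_zero] at h1
  rw [map_zero]
  exact_mod_cast h1.symm

theorem isHomogeneous_complexify {p : Poly 2} {N : ℕ} (hp : p.IsHomogeneous N) :
    (complexify p).IsHomogeneous N := by
  have hX : ∀ j : Fin 2, (MvPolynomial.X j : MvPolynomial (Fin 2) ℂ).IsHomogeneous 1 :=
    MvPolynomial.isHomogeneous_X ℂ
  have h := hp.aeval (![MvPolynomial.C (1 / 2) * (MvPolynomial.X 0 + MvPolynomial.X 1),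
    MvPolynomial.C (-Complex.I / 2) * (MvPolynomial.X 0 - MvPolynomial.X 1)] :
      Fin 2 → MvPolynomial (Fin 2) ℂ) (n := 1) fun i => by
    fin_cases i
    exacts [((hX 0).add (hX 1)).C_mul _, ((hX 0).sub (hX 1)).C_mul _]
  rwa [one_mul] at h

/-- The substitution `z ↦ c z`, `conj z ↦ c⁻¹ conj z`. -/
def rotSubst (c : Circle) : MvPolynomial (Fin 2) ℂ →ₐ[ℂ] MvPolynomial (Fin 2) ℂ :=
  MvPolynomial.aeval ![MvPolynomial.C (c : ℂ) * MvPolynomial.X 0,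
    MvPolynomial.C ((c⁻¹ : Circle) : ℂ) * MvPolynomial.X 1]

/-- In the coordinates z, z̄ rotations are diagonal, so invariance becomes a condition on each
coefficient separately. -/
theorem coeff_rotSubst (c : Circle) (k : Fin 2 →₀ ℕ) (p : MvPolynomial (Fin 2) ℂ) :
    MvPolynomial.coeff k (rotSubst c p)
      = ((c ^ k 0 * (c⁻¹) ^ k 1 : Circle) : ℂ) * MvPolynomial.coeff k p := by
  classical
  induction p using MvPolynomial.induction_on' with
  | monomial l a =>
    have h : rotSubst c (MvPolynomial.monomial l a) =
        MvPolynomial.monomial l (((c ^ l 0 * (c⁻¹) ^ l 1 : Circle) : ℂ) * a) := by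
      rw [rotSubst, MvPolynomial.aeval_monomial, MvPolynomial.monomial_eq,
        Finsupp.prod_fintype _ _ (by simp), Finsupp.prod_fintype _ _ (by simp)]
      simp only [Fin.prod_univ_two, Matrix.cons_val_zero, Matrix.cons_val_one, mul_pow,
        MvPolynomial.algebraMap_eq, Circle.coe_mul, Circle.coe_pow, map_mul, map_pow]
      ring
    rw [h, MvPolynomial.coeff_monomial, MvPolynomial.coeff_monomial]
    split_ifs with hl
    · rw [hl]
    · simp
  | add p q hp hq => rw [map_add, MvPolynomial.coeff_add, hp, hq, MvPolynomial.coeff_add, mul_add]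

theorem complexify_polyComp_rot (c : Circle) (p : Poly 2) :
    complexify (polyComp (rot c) p) = rotSubst c (complexify p) := by
  have h : complexify.comp (polyComp (rot c))
      = ((rotSubst c).restrictScalars ℝ).comp complexify := by
    ext i : 1
    have hc : (c : ℂ) = (c : ℂ).re + (c : ℂ).im * Complex.I := (Complex.re_add_im _).symm
    have hc' : ((c⁻¹ : Circle) : ℂ) = (c : ℂ).re - (c : ℂ).im * Complex.I := by
      rw [Circle.coe_inv_eq_conj]
      apply Complex.ext <;> simp
    apply MvPolynomial.funext
    intro y
    simp only [AlgHom.comp_apply, polyComp, MvPolynomial.aeval_X, Fin.sum_univ_two, coe_rot,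
      AlgHom.restrictScalars_apply]
    fin_cases i
    · simp [complexify, rotSubst, -Circle.coe_inv, hc', -map_inv]
      linear_combination (-y 0 / 2) * hc
    · simp [complexify, rotSubst, -Circle.coe_inv, hc']
      linear_combination (Complex.I / 2 * y 0) * hc +
        ((c : ℂ).im / 2 * (y 0 + y 1)) * Complex.I_sq
  exact DFunLike.congr_fun h p

/-! ### Uniqueness of the superflow field of an odd dihedral group -/

/-- The pair of real polynomials `P` as one complex polynomial in `z, conj z`. -/
def complexifyPair (P : Fin 2 → Poly 2) : MvPolynomial (Fin 2) ℂ :=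
  complexify (P 0) + MvPolynomial.C Complex.I * complexify (P 1)

theorem eval_complexifyPair (P : Fin 2 → Poly 2) (x : Fin 2 → ℝ) :
    MvPolynomial.eval ![toComplex x, conj (toComplex x)] (complexifyPair P) = evalComplex P x := by
  rw [complexifyPair, map_add, map_mul, eval_complexify, eval_complexify, MvPolynomial.eval_C]
  apply Complex.ext <;> simp [evalComplex]

theorem isHomogeneous_complexifyPair {P : Fin 2 → Poly 2} {N : ℕ}
    (hP : ∀ i, (P i).IsHomogeneous N) : (complexifyPair P).IsHomogeneous N :=
  (isHomogeneous_complexify (hP 0)).add ((isHomogeneous_complexify (hP 1)).C_mul _)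

theorem complexify_C (c : ℝ) : complexify (MvPolynomial.C c) = MvPolynomial.C (c : ℂ) := by
  simp [complexify, IsScalarTower.algebraMap_apply ℝ ℂ (MvPolynomial (Fin 2) ℂ)]

theorem complexifyPair_conjNumer_rot (z : Circle) (P : Fin 2 → Poly 2) :
    complexifyPair (conjNumer (rot z) P)
      = MvPolynomial.C ((z⁻¹ : Circle) : ℂ) * rotSubst z (complexifyPair P) := by
  have hinv : (rot z)⁻¹ = rot z⁻¹ := (map_inv rot z).symm
  have hz : ((z⁻¹ : Circle) : ℂ)
      = ((z⁻¹ : Circle) : ℂ).re + ((z⁻¹ : Circle) : ℂ).im * Complex.I := (Complex.re_add_im _).symm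
  have hI : (MvPolynomial.C Complex.I : MvPolynomial (Fin 2) ℂ) * MvPolynomial.C Complex.I
      = -1 := by
    rw [← map_mul]; simp
  have hS : rotSubst z (MvPolynomial.C Complex.I) = MvPolynomial.C Complex.I :=
    MvPolynomial.algHom_C _ _
  rw [hz]
  simp only [complexifyPair, conjNumer, hinv, Fin.sum_univ_two, coe_rot z⁻¹, map_add, map_mul,
    complexify_C, complexify_polyComp_rot, hS, Matrix.of_apply, Matrix.cons_val',
    Matrix.cons_val_zero, Matrix.cons_val_one, Matrix.cons_val_fin_one, map_neg]
  linear_combination (-MvPolynomial.C (((z⁻¹ : Circle) : ℂ).im : ℂ) *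
    rotSubst z (complexify (P 1))) * hI

theorem orderOf_toCircle_one (M : ℕ) [NeZero M] :
    orderOf (ZMod.toCircle (1 : ZMod M)) = M := by
  have h := orderOf_injective (ZMod.toCircle (N := M)).toMonoidHom
    (fun a b hab => ZMod.injective_toCircle hab) (Multiplicative.ofAdd 1)
  rw [orderOf_ofAdd_eq_addOrderOf, ZMod.addOrderOf_one] at h
  exact h

theorem eq_monomial_of_coeff_eq_zero {σ R : Type*} [CommSemiring R] {p : MvPolynomial σ R}
    {k : σ →₀ ℕ} (h : ∀ l, MvPolynomial.coeff l p ≠ 0 → l = k) :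
    p = MvPolynomial.monomial k (MvPolynomial.coeff k p) := by
  classical
  ext l
  rw [MvPolynomial.coeff_monomial]
  split_ifs with hl
  · rw [hl]
  · by_contra h0
    exact hl (h l h0).symm

theorem eval_monomial_fin_two (k : Fin 2 →₀ ℕ) (a u v : ℂ) :
    MvPolynomial.eval ![u, v] (MvPolynomial.monomial k a) = a * (u ^ k 0 * v ^ k 1) := by
  rw [MvPolynomial.eval_monomial, Finsupp.prod_fintype _ _ (by simp)]
  simp [Fin.prod_univ_two]

theorem degree_of_coeff_ne_zero {p : MvPolynomial (Fin 2) ℂ} {N : ℕ} (hp : p.IsHomogeneous N)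
    {k : Fin 2 →₀ ℕ} (hk : MvPolynomial.coeff k p ≠ 0) : k 0 + k 1 = N := by
  have h := not_imp_comm.1 hp.coeff_eq_zero hk
  rwa [Finsupp.degree_eq_sum, Fin.sum_univ_two] at h

/-- Up to scalars, `dihedralField e` is the only invariant field of the dihedral group of order
`2 (2 e + 3)` whose denominator has degree at most `2 e`. -/
theorem exists_eq_smul_dihedralField {e : ℕ} {Q : VectorField 2}
    (hQ : ∀ i, IsTwoHomogeneous (Q i))
    (hinv : ∀ γ ∈ dihedral (2 * e + 3), Superflow.conj γ Q = Q)
    (hdeg : (denom Q).totalDegree ≤ 2 * e) : ∃ c : ℝ, Q = c • dihedralField e := by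
  obtain ⟨hD, hP⟩ := isHomogeneous_denom_numer hQ
  have hD0 := (isReducedForm Q).denom_ne_zero
  set N := (denom Q).totalDegree
  set z : Circle := ZMod.toCircle (1 : ZMod (2 * e + 3)) with hz_def
  have hord : orderOf z = 2 * e + 3 := orderOf_toCircle_one _
  have hzM : z ^ (2 * e + 3) = 1 := by rw [← hord, pow_orderOf_eq_one]
  have hz : rot z ∈ dihedral (2 * e + 3) := mem_dihedral.2 ⟨z, hzM, Or.inl rfl⟩
  have hf : flip ∈ dihedral (2 * e + 3) :=
    mem_dihedral.2 ⟨1, one_pow _, Or.inr (by rw [map_one, one_mul])⟩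
  have hmod : ∀ a b : ℕ, z ^ a = z ^ b → (2 * e + 3 : ℤ) ∣ (b : ℤ) - a := by
    intro a b hab
    rw [pow_eq_pow_iff_modEq, hord] at hab
    exact_mod_cast (Nat.modEq_iff_dvd.1 hab)
  obtain ⟨c, hc0, hcD, hcP⟩ := exists_multiplier_of_conj_eq hQ (hinv _ hz)
  have hcD' : rotSubst z (complexify (denom Q))
      = MvPolynomial.C (c : ℂ) * complexify (denom Q) := by
    rw [← complexify_polyComp_rot, hcD, map_mul, complexify_C]
  have hDk : ∀ k, MvPolynomial.coeff k (complexify (denom Q)) ≠ 0 →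
      ((z ^ k 0 * (z⁻¹) ^ k 1 : Circle) : ℂ) = c := by
    intro k hk
    have h := congrArg (MvPolynomial.coeff k) hcD'
    rw [coeff_rotSubst, MvPolynomial.coeff_C_mul] at h
    exact mul_right_cancel₀ hk h
  obtain ⟨k, hk⟩ := MvPolynomial.ne_zero_iff.1 (complexify_ne_zero hD0)
  -- The multiplier is a real number whose odd power `2 e + 3` equals 1.
  have hc1 : c = 1 := by
    have h1 : (c : ℂ) ^ (2 * e + 3) = 1 := by
      rw [← hDk k hk, ← Circle.coe_pow, mul_pow, ← pow_mul, ← pow_mul, mul_comm (k 0),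
        mul_comm (k 1), pow_mul, pow_mul, inv_pow, hzM]
      simp
    have h2 : c ^ (2 * e + 3) = 1 ^ (2 * e + 3) := by rw [one_pow]; exact_mod_cast h1
    exact (Odd.strictMono_pow ⟨e + 1, by ring⟩).injective h2
  subst hc1
  have hDN : ∀ l, MvPolynomial.coeff l (complexify (denom Q)) ≠ 0 → l 0 + l 1 = N ∧ l 0 = l 1 := by
    intro l hl
    have h1 := degree_of_coeff_ne_zero (isHomogeneous_complexify hD) hl
    have h2 := hDk l hl
    have h3 : z ^ l 0 = z ^ l 1 := by
      have h4 : z ^ l 0 * (z⁻¹) ^ l 1 = 1 := Circle.ext (by rw [h2]; simp)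
      rwa [inv_pow, mul_inv_eq_one] at h4
    refine ⟨h1, ?_⟩
    obtain ⟨q, hq⟩ := hmod _ _ h3
    -- The exponents differ by a multiple of `2 e + 3`, while their sum is at most `2 e`.
    have hq0 : q = 0 := by
      have : (2 * e + 3 : ℤ) * q < (2 * e + 3) * 1 := by omega
      have h5 := lt_of_mul_lt_mul_left this (by positivity)
      have : (2 * e + 3 : ℤ) * (-1) < (2 * e + 3) * q := by omega
      have h6 := lt_of_mul_lt_mul_left this (by positivity)
      omega
    rw [hq0] at hq
    omega
  have hPk : ∀ l, MvPolynomial.coeff l (complexifyPair (numer Q)) ≠ 0 →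
      N = 2 * e ∧ l 0 = 0 ∧ l 1 = 2 * e + 2 := by
    intro l hl
    have h1 := degree_of_coeff_ne_zero (isHomogeneous_complexifyPair hP) hl
    have h2 := complexifyPair_conjNumer_rot z (numer Q)
    have h3 : conjNumer (rot z) (numer Q) = numer Q := by
      funext i
      rw [hcP i, map_one, one_mul]
    rw [h3] at h2
    have h4 := congrArg (MvPolynomial.coeff l) h2
    rw [MvPolynomial.coeff_C_mul, coeff_rotSubst, ← mul_assoc] at h4
    have h5 : z⁻¹ * (z ^ l 0 * (z⁻¹) ^ l 1) = 1 :=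
      Circle.ext (by simpa using mul_right_cancel₀ hl ((one_mul _).trans h4).symm)
    have h6 : z ^ l 0 = z ^ (l 1 + 1) := by
      rw [mul_left_comm, ← pow_succ', inv_pow, mul_inv_eq_one] at h5
      exact h5
    obtain ⟨hk1, hk2⟩ := hDN k hk
    obtain ⟨q, hq⟩ := hmod _ _ h6
    push_cast at hq
    -- Here `l 1 + 1 - l 0 = (2 e + 3) q` and `l 0 + l 1 = N + 2 ≤ 2 e + 2`, which leaves `q = 0` or
    -- `q = 1`. The value 0 would make `l 0 + l 1` odd, whereas `N` is even by `hDN`. The value 1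
    -- forces `l 0 = 0` and `N = 2 e`.
    have hq1 : q = 1 := by
      have : (2 * e + 3 : ℤ) * q < (2 * e + 3) * 2 := by omega
      have h5 := lt_of_mul_lt_mul_left this (by positivity)
      have : (2 * e + 3 : ℤ) * (-1) < (2 * e + 3) * q := by omega
      have h6 := lt_of_mul_lt_mul_left this (by positivity)
      have : q ≠ 0 := by
        rintro rfl
        omega
      omega
    rw [hq1] at hq
    omega
  by_cases hF : complexifyPair (numer Q) = 0
  · refine ⟨0, funext fun i => ?_⟩
    have h1 : numer Q = fun _ => 0 := evalComplex_injective fun x => by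
      rw [← eval_complexifyPair, hF, map_zero]
      apply Complex.ext <;> simp [evalComplex]
    rw [zero_smul, (isReducedForm Q).eq_div i, h1]
    simp
  obtain ⟨l, hl⟩ := MvPolynomial.ne_zero_iff.1 hF
  obtain ⟨hN, hl0, hl1⟩ := hPk l hl
  have hkk := hDN k hk
  have hFm := eq_monomial_of_coeff_eq_zero (p := complexifyPair (numer Q)) (k := l) fun l' hl' => by
    obtain ⟨-, h0, h1⟩ := hPk l' hl'
    ext i
    fin_cases i
    exacts [h0.trans hl0.symm, h1.trans hl1.symm]
  have hDm := eq_monomial_of_coeff_eq_zero (p := complexify (denom Q)) (k := k) fun k' hk' => by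
    have h0 := hDN k' hk'
    ext i
    fin_cases i
    · change k' 0 = k 0
      omega
    · change k' 1 = k 1
      omega
  set κ := MvPolynomial.coeff l (complexifyPair (numer Q))
  set a := MvPolynomial.coeff k (complexify (denom Q))
  have hFx : ∀ x : Fin 2 → ℝ, evalComplex (numer Q) x = κ * conj (toComplex x) ^ (2 * e + 2) := by
    intro x
    rw [← eval_complexifyPair, hFm, eval_monomial_fin_two, hl0, hl1, pow_zero, one_mul]
  have hDx : ∀ x : Fin 2 → ℝ, (MvPolynomial.eval x (denom Q) : ℂ) = a * Complex.normSq (toComplex x) ^ e := by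
    intro x
    have hk0 : k 0 = e := by omega
    have hk1 : k 1 = e := by omega
    rw [← eval_complexify, hDm, eval_monomial_fin_two, hk0, hk1, ← mul_pow, Complex.mul_conj]
  have h10 : toComplex ![1, 0] = 1 := by apply Complex.ext <;> simp [toComplex]
  -- At z = 1 the coefficient `a` is a value of a real polynomial.
  obtain ⟨b, hb⟩ : ∃ b : ℝ, a = b := ⟨_, by
    have h := hDx ![1, 0]
    rw [h10, map_one, Complex.ofReal_one, one_pow, mul_one] at h
    exact h.symm⟩
  have hb0 : b ≠ 0 := by
    rintro rfl
    exact hk (hb.trans Complex.ofReal_zero)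
  have hDeq : denom Q = MvPolynomial.C b * normSqPoly ^ e := by
    refine MvPolynomial.funext fun x => ?_
    have h := hDx x
    rw [hb] at h
    rw [map_mul, map_pow, MvPolynomial.eval_C, eval_normSqPoly]
    exact_mod_cast h
  -- The point z = 1 is fixed by the reflection. The denominator takes the nonzero value `b` there,
  -- so its multiplier is 1; then the numerator's value `κ` equals its own conjugate.
  have hκ : κ.im = 0 := by
    obtain ⟨c', -, hcD', hcP'⟩ := exists_multiplier_of_conj_eq hQ (hinv _ hf)
    have hfx : (flip : Matrix (Fin 2) (Fin 2) ℝ).mulVec ![1, 0] = ![1, 0] := by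
      rw [coe_flip]
      ext i
      fin_cases i <;> simp
    have hev : MvPolynomial.eval ![1, 0] (denom Q) = b := by
      have h := hDx ![1, 0]
      rw [h10, map_one, Complex.ofReal_one, one_pow, mul_one, hb] at h
      exact_mod_cast h
    have hc1 : c' = 1 := by
      have h := congrArg (MvPolynomial.eval ![1, 0]) hcD'
      rw [eval_polyComp, hfx, map_mul, MvPolynomial.eval_C, hev] at h
      exact (mul_right_cancel₀ hb0 ((one_mul b).trans h)).symm
    have h3 : conjNumer flip (numer Q) = numer Q := by
      funext i
      rw [hcP' i, hc1, map_one, one_mul]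
    have h4 := evalComplex_conjNumer_flip (numer Q) ![1, 0]
    rw [h3, hfx, hFx, h10, map_one, one_pow, mul_one] at h4
    exact Complex.conj_eq_iff_im.1 h4.symm
  have hPeq : numer Q = fun i => MvPolynomial.C κ.re * conjPow (2 * e + 2) i := by
    refine evalComplex_injective fun x => ?_
    have hκ' : κ = (κ.re : ℂ) := Complex.ext rfl (by simpa using hκ)
    rw [hFx, hκ', ← evalComplex_conjPow]
    apply Complex.ext <;> simp [evalComplex]
  refine ⟨κ.re / b, funext fun i => ?_⟩
  have hCb : algebraMap (Poly 2) (RatFun 2) (MvPolynomial.C b) ≠ 0 :=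
    algebraMap_ne_zero (by simpa using hb0)
  have hCdiv : algebraMap (Poly 2) (RatFun 2) (MvPolynomial.C (κ.re / b)) =
      algebraMap (Poly 2) (RatFun 2) (MvPolynomial.C κ.re) /
        algebraMap (Poly 2) (RatFun 2) (MvPolynomial.C b) := by
    rw [eq_div_iff hCb, ← map_mul, ← map_mul, div_mul_cancel₀ _ hb0]
  rw [Pi.smul_apply, ratFun_smul_eq, hCdiv, (isReducedForm Q).eq_div i, hDeq, hPeq, dihedralField,
    map_mul, map_mul, div_mul_div_comm]

theorem isSuperflowField_dihedralField (e : ℕ) :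
    IsSuperflowField (dihedral (2 * e + 3)) (dihedralField e) where
  finite := inferInstance
  ne_zero := dihedralField_ne_zero e
  homogeneous := isTwoHomogeneous_dihedralField e
  invariant _ := conj_dihedralField
  unique Q' hQ' hinv := by
    refine or_iff_not_imp_right.2 fun hlt => exists_eq_smul_dihedralField hQ' hinv ?_
    exact (not_lt.1 hlt).trans (totalDegree_denom_dihedralField_le e)

/-! ### The full symmetry group -/

/-- The action of a real matrix on `ℂ`. -/
def complexAction (γ : GL (Fin 2) ℝ) (w : ℂ) : ℂ :=
  toComplex ((γ : Matrix (Fin 2) (Fin 2) ℝ).mulVec ![w.re, w.im])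

theorem complexAction_eq (γ : GL (Fin 2) ℝ) (w : ℂ) :
    complexAction γ w = w.re * (⟨γ 0 0, γ 1 0⟩ : ℂ) + w.im * (⟨γ 0 1, γ 1 1⟩ : ℂ) := by
  apply Complex.ext <;>
    simp [complexAction, toComplex, Matrix.mulVec, dotProduct, Fin.sum_univ_two] <;> ring

theorem complexAction_rot (z : Circle) (w : ℂ) : complexAction (rot z) w = z * w :=
  toComplex_rot_mulVec z ![w.re, w.im]

theorem complexAction_ne_zero (γ : GL (Fin 2) ℝ) {w : ℂ} (hw : w ≠ 0) :
    complexAction γ w ≠ 0 := fun h => by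
  have h1 : (γ : Matrix (Fin 2) (Fin 2) ℝ).mulVec ![w.re, w.im] = 0 := by
    ext i
    fin_cases i
    exacts [congrArg Complex.re h, congrArg Complex.im h]
  have h2 : (![w.re, w.im] : Fin 2 → ℝ) = 0 :=
    Matrix.mulVec_injective_of_isUnit (Units.isUnit γ) (h1.trans (Matrix.mulVec_zero _).symm)
  exact hw (Complex.ext (congrFun h2 0) (congrFun h2 1))

/-- The equation Q ∘ γ = γ ∘ Q at the point `w`, with both denominators cleared so that it also
holds at the origin. -/
theorem complexAction_conj_pow_of_conj_eq {γ : GL (Fin 2) ℝ} {e : ℕ}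
    (h : Superflow.conj γ (dihedralField e) = dihedralField e) (w : ℂ) :
    conj (complexAction γ w) ^ (2 * e + 2) * Complex.normSq w ^ e =
      complexAction γ (conj w ^ (2 * e + 2)) * Complex.normSq (complexAction γ w) ^ e := by
  set A : Matrix (Fin 2) (Fin 2) ℝ := (γ : Matrix (Fin 2) (Fin 2) ℝ) with hA
  set x : Fin 2 → ℝ := ![w.re, w.im] with hx
  set u : Fin 2 → ℝ := fun i => MvPolynomial.eval (A.mulVec x) (conjPow (2 * e + 2) i) with hu
  set v : Fin 2 → ℝ := fun i => MvPolynomial.eval x (conjPow (2 * e + 2) i) with hv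
  have hwx : toComplex x = w := rfl
  have hN := normSqPoly_pow_ne_zero e
  have hpoly : ∀ i, conjNumer γ (conjPow (2 * e + 2)) i * normSqPoly ^ e =
      conjPow (2 * e + 2) i * polyComp γ (normSqPoly ^ e) := fun i => by
    have h1 := conj_apply_eq_div γ (Q := dihedralField e) (fun _ => rfl) i
    rw [h, dihedralField, div_eq_div_iff (algebraMap_ne_zero hN)
      (algebraMap_ne_zero (polyComp_ne_zero γ hN)), ← map_mul, ← map_mul] at h1
    exact (IsFractionRing.injective (Poly 2) (RatFun 2) h1).symm
  have hvec : (Complex.normSq w ^ e) • ((γ⁻¹ : GL (Fin 2) ℝ) : Matrix (Fin 2) (Fin 2) ℝ).mulVec u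
      = (Complex.normSq (complexAction γ w) ^ e) • v := by
    funext i
    have h1 := congrArg (MvPolynomial.eval x) (hpoly i)
    simp only [map_mul, conjNumer, map_sum, MvPolynomial.eval_C, eval_polyComp, map_pow,
      eval_normSqPoly] at h1
    rw [Pi.smul_apply, Pi.smul_apply, smul_eq_mul, smul_eq_mul, mul_comm, mul_comm _ (v i)]
    exact h1
  have hvec2 := congrArg A.mulVec hvec
  rw [Matrix.mulVec_smul, Matrix.mulVec_smul, Matrix.mulVec_mulVec, hA, Units.mul_inv,
    Matrix.one_mulVec, ← hA] at hvec2
  have hue : toComplex u = conj (complexAction γ w) ^ (2 * e + 2) :=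
    evalComplex_conjPow _ (A.mulVec x)
  have hve : toComplex (A.mulVec v) = complexAction γ (conj w ^ (2 * e + 2)) := by
    have h1 : toComplex v = conj w ^ (2 * e + 2) := evalComplex_conjPow _ x
    rw [← h1, complexAction]
    congr 2
    ext i
    fin_cases i <;> rfl
  have hsm : ∀ (r : ℝ) (y : Fin 2 → ℝ), toComplex (r • y) = toComplex y * r := fun r y => by
    apply Complex.ext <;> simp [toComplex, mul_comm]
  have h2 := congrArg toComplex hvec2
  rw [hsm, hsm, hue, hve] at h2
  push_cast at h2
  exact h2

/-- A linear symmetry of `dihedralField e` is an isometry. -/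
theorem norm_complexAction_of_conj_eq {γ : GL (Fin 2) ℝ} {e : ℕ}
    (h : Superflow.conj γ (dihedralField e) = dihedralField e) {w : ℂ} (hw : ‖w‖ = 1) :
    ‖complexAction γ w‖ = 1 := by
  have hpos : ∀ u : ℂ, ‖u‖ = 1 → 0 < ‖complexAction γ u‖ := fun u hu =>
    norm_pos_iff.2 (complexAction_ne_zero γ (norm_pos_iff.1 (hu ▸ one_pos)))
  have hsq : ∀ u : ℂ, ‖u‖ = 1 →
      ‖complexAction γ (conj u ^ (2 * e + 2))‖ = ‖complexAction γ u‖ ^ 2 := by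
    intro u hu
    have h1 := congrArg norm (complexAction_conj_pow_of_conj_eq h u)
    simp only [norm_mul, norm_pow, Complex.norm_real, Complex.norm_conj, Complex.normSq_eq_norm_sq,
      hu, norm_norm, norm_one, one_pow, mul_one] at h1
    have hne : (‖complexAction γ u‖ ^ 2) ^ e ≠ 0 := pow_ne_zero _ (pow_ne_zero _ (hpos u hu).ne')
    apply mul_right_cancel₀ hne
    rw [← h1]
    ring
  have hmem : ∀ u : ℂ, ‖u‖ = 1 → ‖conj u ^ (2 * e + 2)‖ = 1 := fun u hu => by
    rw [norm_pow, Complex.norm_conj, hu, one_pow]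
  have hcont : Continuous fun u => ‖complexAction γ u‖ := by
    simp only [complexAction_eq]
    fun_prop
  have hS : IsCompact (Metric.sphere (0 : ℂ) 1) := isCompact_sphere 0 1
  have hne : (Metric.sphere (0 : ℂ) 1).Nonempty := ⟨w, by simpa using hw⟩
  -- By `hsq` the square of any attained value is attained too. So the maximum m satisfies m² ≤ m
  -- and the minimum satisfies m ≤ m²; both being positive, all values equal 1.
  obtain ⟨u, hu, hmax⟩ := hS.exists_isMaxOn hne hcont.continuousOn
  obtain ⟨v, hv, hmin⟩ := hS.exists_isMinOn hne hcont.continuousOn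
  rw [mem_sphere_zero_iff_norm] at hu hv
  have h1 : ‖complexAction γ (conj u ^ (2 * e + 2))‖ ≤ ‖complexAction γ u‖ :=
    hmax (mem_sphere_zero_iff_norm.2 (hmem u hu))
  have h2 : ‖complexAction γ v‖ ≤ ‖complexAction γ (conj v ^ (2 * e + 2))‖ :=
    hmin (mem_sphere_zero_iff_norm.2 (hmem v hv))
  have h3 : ‖complexAction γ w‖ ≤ ‖complexAction γ u‖ := hmax (mem_sphere_zero_iff_norm.2 hw)
  have h4 : ‖complexAction γ v‖ ≤ ‖complexAction γ w‖ := hmin (mem_sphere_zero_iff_norm.2 hw)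
  rw [hsq u hu] at h1
  rw [hsq v hv] at h2
  have := hpos u hu
  have := hpos v hv
  apply le_antisymm <;> nlinarith

theorem exists_eq_rot_or_eq_rot_mul_flip_of_norm {γ : GL (Fin 2) ℝ}
    (h : ∀ w : ℂ, ‖w‖ = 1 → ‖complexAction γ w‖ = 1) : ∃ z, γ = rot z ∨ γ = rot z * flip := by
  have hsq : ∀ w : ℂ, Complex.normSq w = 1 → Complex.normSq (complexAction γ w) = 1 := by
    intro w hw
    have h1 : ‖w‖ = 1 := by rw [Complex.norm_def, hw, Real.sqrt_one]
    rw [Complex.normSq_eq_norm_sq, h w h1, one_pow]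
  have h1 := hsq 1 (by simp)
  have h2 := hsq Complex.I (by simp)
  -- The vectors 1 and i give unit columns; a rational unit vector off the axes then makes the
  -- columns orthogonal.
  have h3 := hsq ⟨3 / 5, 4 / 5⟩ (by norm_num [Complex.normSq_apply])
  simp only [complexAction_eq, Complex.normSq_apply, Complex.add_re, Complex.add_im,
    Complex.re_ofReal_mul, Complex.im_ofReal_mul, Complex.one_re, Complex.one_im, Complex.I_re,
    Complex.I_im] at h1 h2 h3
  apply exists_eq_rot_or_eq_rot_mul_flip
  ext i j
  rw [Matrix.mul_apply, Fin.sum_univ_two]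
  simp only [Matrix.transpose_apply]
  fin_cases i <;> fin_cases j <;> simp <;> linarith

/-- At the point 1 the symmetry equation reads z̄^(2e+2) = z. -/
theorem pow_eq_one_of_conj_rot_eq {e : ℕ} {z : Circle}
    (h : Superflow.conj (rot z) (dihedralField e) = dihedralField e) : z ^ (2 * e + 3) = 1 := by
  have h1 := complexAction_conj_pow_of_conj_eq h 1
  simp only [complexAction_rot, map_one, one_pow, mul_one, Circle.normSq_coe,
    Complex.ofReal_one, ← Circle.coe_inv_eq_conj] at h1
  have h2 : (z⁻¹) ^ (2 * e + 2) = z := Circle.ext (by rw [Circle.coe_pow, h1])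
  calc z ^ (2 * e + 3) = z ^ (2 * e + 2) * z := pow_succ _ _
    _ = z ^ (2 * e + 2) * (z⁻¹) ^ (2 * e + 2) := by rw [h2]
    _ = 1 := by rw [← mul_pow, mul_inv_cancel, one_pow]

theorem symmetryGroup_dihedralField (e : ℕ) :
    symmetryGroup (dihedralField e) = dihedral (2 * e + 3) := by
  ext γ
  refine ⟨fun h => ?_, fun h => conj_dihedralField h⟩
  have h : Superflow.conj γ (dihedralField e) = dihedralField e := h
  obtain ⟨z, rfl | rfl⟩ := exists_eq_rot_or_eq_rot_mul_flip_of_norm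
    fun w => norm_complexAction_of_conj_eq h
  · exact mem_dihedral.2 ⟨z, pow_eq_one_of_conj_rot_eq h, Or.inl rfl⟩
  · refine mem_dihedral.2 ⟨z, pow_eq_one_of_conj_rot_eq ?_, Or.inr rfl⟩
    rw [conj_mul] at h
    -- As `flip` is itself a symmetry, it can be cancelled, which leaves a rotation.
    rw [← conj_inv_conj flip (Superflow.conj (rot z) _), h, flip_inv, conj_flip_dihedralField]

/-! ### Classification -/

theorem IsSuperflow.exists_dihedralGroup {Γ : Subgroup (GL (Fin 2) ℝ)}
    {φ : (Fin 2 → ℝ) → (Fin 2 → ℝ)} (h : IsSuperflow Γ φ) :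
    ∃ d : ℕ, 1 ≤ d ∧ Nonempty (Γ ≃* DihedralGroup (2 * d + 1)) := by
  obtain ⟨Q, -, hQ⟩ := h
  obtain ⟨g, d, hd, hΓ⟩ := hQ.exists_conj_eq_dihedral
  refine ⟨d, hd, ⟨?_⟩⟩
  exact (Γ.equivMapOfInjective (MulAut.conj g).toMonoidHom (MulAut.conj g).injective).trans
    ((MulEquiv.subgroupCongr hΓ).trans (dihedralEquiv _).symm)

/-- An abstract isomorphism determines the conjugacy class: noncommutativity rules out groups of
rotations, and the order fixes `M`. The standard field is then carried back to Γ by conjugation. -/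
theorem exists_isSuperflow_of_mulEquiv {Γ : Subgroup (GL (Fin 2) ℝ)} {d : ℕ} (hd : 1 ≤ d)
    (f : Γ ≃* DihedralGroup (2 * d + 1)) : ∃ φ, IsSuperflow Γ φ := by
  have : Finite Γ := Finite.of_injective _ f.injective
  have hcard : Nat.card Γ = 2 * (2 * d + 1) := by
    rw [Nat.card_congr f.toEquiv, DihedralGroup.nat_card]
  obtain ⟨g, hΓ⟩ := exists_conj_rotations_or_dihedral Γ
  have eqv := Γ.equivMapOfInjective (MulAut.conj g).toMonoidHom (MulAut.conj g).injective
  rcases hΓ with hΓ | ⟨M, hM, hΓ⟩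
  · exfalso
    refine DihedralGroup.not_commutative (n := 2 * d + 1) (by omega) (by omega) ⟨⟨fun a b => ?_⟩⟩
    apply (f.symm.trans eqv).injective
    rw [map_mul, map_mul]
    obtain ⟨z, hz⟩ := hΓ _ ((f.symm.trans eqv) a).2
    obtain ⟨w, hw⟩ := hΓ _ ((f.symm.trans eqv) b).2
    apply Subtype.ext
    rw [Subgroup.coe_mul, Subgroup.coe_mul, hz, hw, ← map_mul, ← map_mul, mul_comm]
  · have hcard' : Nat.card (dihedral M) = 2 * M := by
      rw [← Nat.card_congr (dihedralEquiv M).toEquiv, DihedralGroup.nat_card]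
    rw [← hΓ, ← Nat.card_congr eqv.toEquiv, hcard] at hcard'
    obtain rfl : M = 2 * (d - 1) + 3 := by omega
    have hQ := (isSuperflowField_dihedralField (d - 1)).conj g
    have hback : (dihedral (2 * (d - 1) + 3)).map (MulAut.conj g⁻¹).toMonoidHom = Γ := by
      rw [← hΓ, Subgroup.map_map]
      convert Γ.map_id
      ext1 γ
      simp [mul_assoc]
    rw [hback] at hQ
    obtain ⟨φ, hφ⟩ := exists_isProjectiveFlow hQ.homogeneous
    exact ⟨φ, _, hφ, hQ⟩

end Dihedral

end Superflow

end

theorem mainTheorem1 :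
    (∀ d : ℕ, 1 ≤ d → ∃ Γ : Subgroup (GL (Fin 2) ℝ),
      Nonempty (Γ ≃* DihedralGroup (2 * d + 1)) ∧
        ∃ φ : (Fin 2 → ℝ) → (Fin 2 → ℝ), Superflow.IsSuperflowWithSymmetryGroup Γ φ) ∧
    (∀ d : ℕ, 1 ≤ d → ∀ Γ : Subgroup (GL (Fin 2) ℝ),
      Nonempty (Γ ≃* DihedralGroup (2 * d)) →
        ¬ ∃ φ : (Fin 2 → ℝ) → (Fin 2 → ℝ), Superflow.IsSuperflow Γ φ) ∧
    (∀ d : ℕ, 1 ≤ d → ∀ Γ : Subgroup (GL (Fin 2) ℝ),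
      Nonempty (Γ ≃* Multiplicative (ZMod d)) →
        ¬ ∃ φ : (Fin 2 → ℝ) → (Fin 2 → ℝ), Superflow.IsSuperflow Γ φ) ∧
    (∀ Γ : Subgroup (GL (Fin 2) ℝ),
      (∃ φ : (Fin 2 → ℝ) → (Fin 2 → ℝ), Superflow.IsSuperflow Γ φ) ↔
        ∃ d : ℕ, 1 ≤ d ∧ Nonempty (Γ ≃* DihedralGroup (2 * d + 1))) := by
  refine ⟨fun d hd => ?_, fun d hd Γ ⟨f⟩ ⟨φ, hφ⟩ => ?_, fun d hd Γ ⟨f⟩ ⟨φ, hφ⟩ => ?_,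
    fun Γ => ⟨fun ⟨φ, hφ⟩ => hφ.exists_dihedralGroup,
      fun ⟨d, hd, ⟨f⟩⟩ => Superflow.exists_isSuperflow_of_mulEquiv hd f⟩⟩
  · obtain ⟨e, rfl⟩ := Nat.exists_eq_add_of_le' hd
    obtain ⟨φ, hφ⟩ := Superflow.exists_isProjectiveFlow (Superflow.isTwoHomogeneous_dihedralField e)
    exact ⟨Superflow.dihedral (2 * e + 3), ⟨(Superflow.dihedralEquiv _).symm⟩, φ, _, hφ,
      Superflow.isSuperflowField_dihedralField e, Superflow.symmetryGroup_dihedralField e⟩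
  · obtain ⟨k, -, ⟨f'⟩⟩ := hφ.exists_dihedralGroup
    -- The orders would give 4d = 2(2k + 1), impossible by parity.
    have h := Nat.card_congr (f.symm.trans f').toEquiv
    rw [DihedralGroup.nat_card, DihedralGroup.nat_card] at h
    omega
  · obtain ⟨k, hk, ⟨f'⟩⟩ := hφ.exists_dihedralGroup
    -- Since k ≥ 1, the dihedral group of order 2(2k + 1) is not commutative, unlike a cyclic group.
    refine DihedralGroup.not_commutative (n := 2 * k + 1) (by omega) (by omega) ⟨⟨fun a b => ?_⟩⟩
    apply (f'.symm.trans f).injective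
    rw [map_mul, map_mul, mul_comm]
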